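/- \textbf{Setting.} Let $n=mk$ with $k\ge 1$: $n$ qubits, grouped into $m=n/k$ blocks of $k$ qubits, and $d=2^n$. A \emph{stabilizer basis} of $k$ qubits is an orthonormal basis $\{U^\dagger|b\rangle : b\in\{0,1\}^k\}$ with $U$ a Clifford unitary; two bases given by $U,V$ are \emph{mutually unbiased} if $|\langle b|UV^\dagger|b'\rangle|^2=2^{-k}$ for all $b,b'$. Choose in every block a family of $2^k+1$ pairwise mutually unbiased stabilizer bases, and consider the $(2^k+1)^{n/k}$ product bases of the $n$ qubits that arise by choosing one basis of the family in each block; let $U_j$ be the corresponding tensor-product unitaries. Each product basis is measured $M$ times, always on a fresh copy of the state $\rho$, so that $T=M(2^k+1)^{n/k}$ copies are used and the outcomes are independent and follow the Born rule. A basis $j$ is \emph{informative} for a Pauli string $P\in\{I,X,Y,Z\}^{n}$ if $U_jPU_j^\dagger=\pm Q$ with $Q\in\{I,Z\}^{n}$; an outcome $b$ of it then gives the value $\langle b|U_jPU_j^\dagger|b\rangle\in\{\pm1\}$. Let $N_P$ be the number of informative bases for $P$, let $\mu_P$ be the sum of the $MN_P$ values of $P$ so obtained, and let $$\hat\rho=\sum_{P}\frac{\mu_P}{2^n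 M N_P}\,P .$$ Write $\|A\|_{\mathrm{tr}}$ for the sum of the singular values of $A$. \textbf{Theorem 2 (Full rank).} For every $k\ge1$ there is a family of $2^k+1$ pairwise mutually unbiased stabilizer bases of $k$ qubits. There are universal constants $C,D>0$ such that for all $n=mk$ and all choices of such families in the blocks the following holds. (i) Every product basis is measured, up to the naming of the outcomes, by a circuit that consists of one-qubit Clifford gates and two-qubit Clifford gates on neighbouring qubits of the same block (each block being a line of qubits), followed by a computational-basis measurement, and that has depth at most $Dk$. In particular, if $k\le\kappa\log_2 n$, then the depth is at most $D\kappa\log_2 n$, i.e. $O(\log n)$ for fixed $\kappa$. (ii) For every $n$-qubit state $\rho$ (in particular for every state of full rank $d$) and every $M\ge1$, the estimator is unbiased: $\mathbb E\,\hat\rho=\rho$. (iii) Suppose $k2^k\ge n$ (for example $k=\log_2 n$). Then for every $n$-qubit state $\rho$, every $\varepsilon>0$, $\delta\in(0,1)$ and $M\ge1$: if $$T=M(2^k+1)^{n/k}\ \ge\ C\left(1+\sqrt{2\ln(1/\delta)}\right)^2\frac{d^3}{\varepsilon^2},$$ then $\Pr\left(\|\hat\rho-\rho\|_{\mathrm{tr}}\ge\varepsilon\right)\le\delta$.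 If moreover $\varepsilon\le d$, then some $M\ge1$ satisfies this condition with $T\le 2C\left(1+\sqrt{2\ln(1/\delta)}\right)^2 d^3/\varepsilon^2$; so $T=O(d^3/\varepsilon^2)$ samples suffice for fixed $\delta$. -/

import Mathlib

open MeasureTheory
open scoped Matrix ComplexOrder

noncomputable section

namespace ShallowQST

/-! ### Qubit registers, Pauli strings, Clifford unitaries

The qubits are labelled by a finite type `ι`; a computational basis state is a bit string
`ι → Fin 2`, and operators are complex matrices indexed by bit strings. -/

/-- Bit strings on the register `ι`. -/
abbrev Bits (ι : Type) : Type := ι → Fin 2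

/-- Operators on the register `ι` (square matrices of size `2 ^ |ι|`). -/
abbrev Op (ι : Type) : Type := Matrix (Bits ι) (Bits ι) ℂ

/-- The single-qubit Pauli matrices `I, X, Y, Z`, in this order. -/
def pauli : Fin 4 → Matrix (Fin 2) (Fin 2) ℂ :=
  ![1, !![0, 1; 1, 0], !![0, -Complex.I; Complex.I, 0], !![1, 0; 0, -1]]

section Register

variable {ι : Type} [Fintype ι] [DecidableEq ι]

/-- The Pauli string `⨂ i, pauli (P i)`. -/
def pauliString (P : ι → Fin 4) : Op ι :=
  Matrix.of fun s t => ∏ i, pauli (P i) (s i) (t i)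

/-- The operator `A` is, up to a sign, a tensor product of `I`s and `Z`s. -/
def IsSignedZString (A : Op ι) : Prop :=
  ∃ Q : ι → Fin 4, (∀ i, Q i = 0 ∨ Q i = 3) ∧ (A = pauliString Q ∨ A = -pauliString Q)

/-- Clifford unitaries: unitaries that conjugate Pauli strings to signed Pauli strings. -/
def IsClifford (U : Op ι) : Prop :=
  U ∈ Matrix.unitaryGroup (Bits ι) ℂ ∧
    ∀ P : ι → Fin 4, ∃ Q : ι → Fin 4,
      U * pauliString P * Uᴴ = pauliString Q ∨ U * pauliString P * Uᴴ = -pauliString Q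

/-- Quantum states: positive semidefinite matrices of unit trace. -/
def IsDensityMatrix (ρ : Op ι) : Prop :=
  ρ.PosSemidef ∧ ρ.trace = 1

/-- The trace norm, i.e. the sum of the singular values (square roots of the eigenvalues
of `Aᴴ * A`). -/
def traceNorm (A : Op ι) : ℝ :=
  ∑ i, √((Matrix.isHermitian_conjTranspose_mul_self A).eigenvalues i)

/-- Born probability `⟨b| U ρ Uᴴ |b⟩` of the outcome `b`, when `U` is applied to `ρ` and all
qubits are then measured in the computational basis. -/
def bornProb (U ρ : Op ι) (b : Bits ι) : ℝ :=
  ((U * ρ * Uᴴ) b b).re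

/-- The law of the outcome of this measurement. -/
def bornMeasure (U ρ : Op ι) : Measure (Bits ι) :=
  ∑ b, ENNReal.ofReal (bornProb U ρ b) • Measure.dirac b

/-- `V` and `U` define the same measurement up to the naming of the outcomes: the bases
`Vᴴ|b⟩` and `Uᴴ|b⟩` consist of the same states, up to phases and order. -/
def SameBasis (V U : Op ι) : Prop :=
  ∃ π : Equiv.Perm (Bits ι), ∀ b,
    Vᴴ * Matrix.single b b 1 * V = Uᴴ * Matrix.single (π b) (π b) 1 * U

end Register

/-- A complete family of `2 ^ k + 1` mutually unbiased stabilizer bases of `k` qubits. The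
`j`-th basis consists of the states `(U j)ᴴ|b⟩`, with `U j` a Clifford unitary. -/
structure IsStabilizerMUB {k : ℕ} (U : Fin (2 ^ k + 1) → Op (Fin k)) : Prop where
  clifford : ∀ j, IsClifford (U j)
  unbiased : ∀ j j', j ≠ j' → ∀ b b', ‖(U j * (U j')ᴴ) b b'‖ ^ 2 = 1 / 2 ^ k

/-! ### Product bases on `m` blocks of `k` qubits

The qubit `(i, q)` is the `q`-th qubit of the `i`-th block. -/

/-- The tensor product `⨂ i, V i` of one `k`-qubit operator for each block. -/
def blockTensor {m k : ℕ} (V : Fin m → Op (Fin k)) : Op (Fin m × Fin k) :=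
  Matrix.of fun s t => ∏ i, V i (fun q => s (i, q)) (fun q => t (i, q))

/-- Labels of the product bases: a choice of one of the `2 ^ k + 1` bases in every block. -/
abbrev Setting (m k : ℕ) : Type := Fin m → Fin (2 ^ k + 1)

/-- The unitary that is applied before the computational-basis measurement in the setting `j`. -/
def settingUnitary {m k : ℕ} (U : Fin m → Fin (2 ^ k + 1) → Op (Fin k)) (j : Setting m k) :
    Op (Fin m × Fin k) :=
  blockTensor fun i => U i (j i)

/-- Data of the experiment: one bit string for every setting and every one of `M` repetitions. -/
abbrev Data (m k M : ℕ) : Type := Setting m k × Fin M → Bits (Fin m × Fin k)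

/-- The law of the data: every measurement uses a fresh copy of `ρ`, so the outcomes are
independent. -/
def experiment {m k : ℕ} (U : Fin m → Fin (2 ^ k + 1) → Op (Fin k)) (M : ℕ)
    (ρ : Op (Fin m × Fin k)) : Measure (Data m k M) :=
  Measure.pi fun a => bornMeasure (settingUnitary U a.1) ρ

/-- The setting `j` gives information on the Pauli string `P`: conjugation by its unitary turns
`P` into a signed string of `I`s and `Z`s. -/
def Informative {m k : ℕ} (U : Fin m → Fin (2 ^ k + 1) → Op (Fin k)) (P : Fin m × Fin k → Fin 4)
    (j : Setting m k) : Prop :=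
  IsSignedZString (settingUnitary U j * pauliString P * (settingUnitary U j)ᴴ)

open scoped Classical in
/-- The number `N_P` of settings that give information on `P`. -/
def numInformative {m k : ℕ} (U : Fin m → Fin (2 ^ k + 1) → Op (Fin k))
    (P : Fin m × Fin k → Fin 4) : ℕ :=
  (Finset.univ.filter fun j => Informative U P j).card

/-- The value `±1` of `P` that is read off from the outcome `b` in an informative setting `j`. -/
def pauliValue {m k : ℕ} (U : Fin m → Fin (2 ^ k + 1) → Op (Fin k)) (P : Fin m × Fin k → Fin 4)
    (j : Setting m k) (b : Bits (Fin m × Fin k)) : ℝ :=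
  ((settingUnitary U j * pauliString P * (settingUnitary U j)ᴴ) b b).re

open scoped Classical in
/-- The sum `μ_P` of the `M * N_P` values of `P` read off from all informative outcomes. -/
def pauliSum {m k M : ℕ} (U : Fin m → Fin (2 ^ k + 1) → Op (Fin k)) (P : Fin m × Fin k → Fin 4)
    (x : Data m k M) : ℝ :=
  ∑ a : Setting m k × Fin M, if Informative U P a.1 then pauliValue U P a.1 (x a) else 0

/-- The Pauli-averaging estimator `∑ P, μ_P / (2 ^ n * M * N_P) * P`, for `n = m * k` qubits. -/
def estimator {m k M : ℕ} (U : Fin m → Fin (2 ^ k + 1) → Op (Fin k)) (x : Data m k M) :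
    Op (Fin m × Fin k) :=
  ∑ P : Fin m × Fin k → Fin 4,
    ((pauliSum U P x / (2 ^ (m * k) * M * numInformative U P) : ℝ) : ℂ) • pauliString P

/-! ### Local Clifford circuits and their depth -/

/-- A gate inside one block: a Clifford unitary on one qubit or on two qubits that are
neighbours on the line formed by the qubits of that block. -/
structure LocalGate (m k : ℕ) where
  supp : Finset (Fin m × Fin k)
  near : ∀ p ∈ supp, ∀ q ∈ supp, p.1 = q.1 ∧ (p.2 : ℕ) ≤ (q.2 : ℕ) + 1
  mat : Op supp
  clifford : IsClifford mat

open scoped Classical in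
/-- A gate as an operator on the whole register: identity outside its support. -/
def LocalGate.toOp {m k : ℕ} (g : LocalGate m k) : Op (Fin m × Fin k) :=
  Matrix.of fun s t =>
    if ∀ q, q ∉ g.supp → s q = t q then g.mat (fun q => s q) (fun q => t q) else 0

/-- A layer: gates that are applied in parallel, hence have disjoint supports. -/
structure Layer (m k : ℕ) where
  gates : List (LocalGate m k)
  disjoint : gates.Pairwise fun g h => Disjoint g.supp h.supp

/-- The unitary of a layer. -/
def Layer.toOp {m k : ℕ} (l : Layer m k) : Op (Fin m × Fin k) :=
  (l.gates.map LocalGate.toOp).prod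

/-- A circuit is a list of layers, the first one being applied first; its depth is the length
of the list. -/
abbrev Circuit (m k : ℕ) : Type := List (Layer m k)

/-- The unitary of a circuit. -/
def Circuit.toOp {m k : ℕ} (c : Circuit m k) : Op (Fin m × Fin k) :=
  (c.map Layer.toOp).reverse.prod

end ShallowQST

end

/-!
Pauli strings are handled through their labels `P : ι → Fin 4`, which carry the symplectic form
`symp` that records commutation. `Maps A P Q` says that conjugation by `A` sends the string `P` to a
multiple of the string `Q`; as strings are involutions the multiple is a sign, so a unitary is
Clifford as soon as it maps every label in this sense, and it then permutes the labels and preserves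
`symp`.

Mutually unbiased bases. Commuting independent Pauli strings can be diagonalized by a Clifford unitary
(`exists_diagonalizing`): the strings are brought one after the other to the form `Z` on the last
free qubit, with gates built from the operators `(P + R) / √2`, which exchange two anticommuting
strings. Applied to the strings `X^x Z^{A x}`, with `A` the Gram matrix of `tr (a x y)` on the field
with `2 ^ k` elements, this gives one basis for each `a`. Nondegeneracy of the trace form makes the
stabilizer groups intersect trivially, which means that the bases are unbiased
(`unbiased_of_disjoint`, `exists_isStabilizerMUB`).

Depth. A gate on two neighbouring qubits can push a Pauli string off the first of them, so one
sweep along the block clears all but the last free qubit. The sweep for the next string may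
follow two sites behind, and `k` pipelined sweeps take at most `2 k` layers (`exists_sweep`,
`exists_block_schedule`). A unitary that diagonalizes the stabilizer group of a basis measures that
basis up to the naming of the outcomes (`sameBasis_of_maps`).

Unbiasedness. Conversely, the stabilizer groups of `2 ^ k + 1` mutually unbiased bases intersect
trivially, so by counting they partition the nontrivial strings (`numBases_of_ne_zero`).
Hence every Pauli string has an informative setting, and each informative outcome has the right mean.

Sample complexity. The Pauli coefficients of the estimator are a sum of independent vectors, one
per measurement. For nontrivial strings in a block there is one informative basis, for the trivial
string there are `q + 1`, where `q = 2 ^ k`, and so the squared norm of a summand is at most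
`(q ^ 2 / (q + 1)) ^ m / (d M) ^ 2` (`norm_contribution_sq_le`). With `T = M (q + 1) ^ m` summands the
total is `1 / M`. The norm of the error has mean at most `1 / √M` by additivity of variances, and
McDiarmid's inequality (`mcdiarmid`) bounds its deviation. The trace norm costs a
factor `d` (`traceNorm_sum_le`), and `(q + 1) ^ m ≤ e d` for `m ≤ q` (`settings_le`) turns
`M ≥ d ^ 2 (1 + s) ^ 2 / ε ^ 2` into the condition on `T`.
-/

set_option linter.unusedSectionVars false

noncomputable section

namespace ShallowQST

/-! ### Pauli strings -/

/-- The tensor product `⨂ i, A i` of square matrices. -/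
def tensor {ι α : Type} [Fintype ι] (A : ι → Matrix α α ℂ) : Matrix (ι → α) (ι → α) ℂ :=
  Matrix.of fun s t => ∏ i, A i (s i) (t i)

lemma tensor_mul {ι α : Type} [Fintype ι] [DecidableEq ι] [Fintype α]
    (A B : ι → Matrix α α ℂ) : tensor A * tensor B = tensor fun i => A i * B i := by
  ext s t
  simp only [tensor, Matrix.mul_apply, Matrix.of_apply, ← Finset.prod_mul_distrib]
  rw [Finset.prod_univ_sum, Fintype.piFinset_univ]

lemma tensor_conjTranspose {ι α : Type} [Fintype ι] (A : ι → Matrix α α ℂ) :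
    (tensor A)ᴴ = tensor fun i => (A i)ᴴ := by
  ext s t
  simp [tensor, Matrix.conjTranspose_apply]

lemma tensor_smul {ι α : Type} [Fintype ι] (c : ι → ℂ) (A : ι → Matrix α α ℂ) :
    (tensor fun i => c i • A i) = (∏ i, c i) • tensor A := by
  ext s t
  simp [tensor, Finset.prod_mul_distrib]

lemma tensor_one {ι α : Type} [Fintype ι] [DecidableEq α] :
    (tensor fun _ : ι => (1 : Matrix α α ℂ)) = 1 := by
  classical
  ext s t
  simp only [tensor, Matrix.of_apply, Matrix.one_apply, Finset.prod_ite_zero, Finset.prod_const_one,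
    funext_iff, Finset.mem_univ, true_imp_iff]

lemma trace_tensor {ι α : Type} [Fintype ι] [DecidableEq ι] [Fintype α]
    (A : ι → Matrix α α ℂ) : (tensor A).trace = ∏ i, (A i).trace := by
  simp only [Matrix.trace, Matrix.diag, tensor, Matrix.of_apply]
  rw [Finset.prod_univ_sum, Fintype.piFinset_univ]

/-- The character `ZMod 2 → {1, -1}`. -/
def sgn (a : ZMod 2) : ℂ := if a = 0 then 1 else -1

@[simp] lemma sgn_zero : sgn 0 = 1 := rfl

@[simp] lemma sgn_one : sgn 1 = -1 := rfl

lemma sgn_add (a b : ZMod 2) : sgn (a + b) = sgn a * sgn b := by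
  revert a b
  have h : (1 : ZMod 2) + 1 = 0 := rfl
  have key : ∀ a : ZMod 2, a = 0 ∨ a = 1 := by decide
  intro a b
  rcases key a with rfl | rfl <;> rcases key b with rfl | rfl <;> simp [h]

lemma sgn_sum {κ : Type} (s : Finset κ) (f : κ → ZMod 2) :
    sgn (∑ i ∈ s, f i) = ∏ i ∈ s, sgn (f i) := by
  classical
  induction s using Finset.induction_on with
  | empty => simp
  | insert a s ha ih => rw [Finset.sum_insert ha, Finset.prod_insert ha, sgn_add, ih]

lemma sgn_injective : Function.Injective sgn := by
  have key : ∀ a : ZMod 2, a = 0 ∨ a = 1 := by decide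
  have h1 : (1 : ℂ) ≠ -1 := by norm_num
  intro a b
  rcases key a with rfl | rfl <;> rcases key b with rfl | rfl <;> simp [h1, h1.symm]

/-- The commutation form on `{I, X, Y, Z}`: `1` exactly for anticommuting Pauli matrices. -/
def om (a b : Fin 4) : ZMod 2 := if a = 0 ∨ b = 0 ∨ a = b then 0 else 1

/-- The product of Pauli matrices up to phase. -/
def mulLabel : Fin 4 → Fin 4 → Fin 4 :=
  ![![0, 1, 2, 3], ![1, 0, 3, 2], ![2, 3, 0, 1], ![3, 2, 1, 0]]

lemma om_mulLabel (a b c : Fin 4) : om a (mulLabel b c) = om a b + om a c := by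
  revert a b c; decide

lemma om_comm (a b : Fin 4) : om a b = om b a := by revert a b; decide

lemma exists_om_eq_one (a : Fin 4) (ha : a ≠ 0) : ∃ b, om a b = 1 := by revert a; decide

lemma om_three_eq_zero {a : Fin 4} (h : om a 3 = 0) : a = 0 ∨ a = 3 := by revert a; decide

lemma om_eq_zero_of_diagonal {a b : Fin 4} (ha : a = 0 ∨ a = 3) (hb : b = 0 ∨ b = 3) :
    om a b = 0 := by revert a b; decide

lemma pauli_mul (a b : Fin 4) : ∃ c : ℂ, pauli a * pauli b = c • pauli (mulLabel a b) := by
  fin_cases a <;> fin_cases b <;>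
  first
  | (refine ⟨1, ?_⟩; ext i j; fin_cases i <;> fin_cases j <;> simp [pauli, mulLabel]; done)
  | (refine ⟨Complex.I, ?_⟩
     ext i j; fin_cases i <;> fin_cases j <;> simp [pauli, mulLabel]; done)
  | (refine ⟨-Complex.I, ?_⟩
     ext i j; fin_cases i <;> fin_cases j <;> simp [pauli, mulLabel])

lemma pauli_mul_comm (a b : Fin 4) :
    pauli a * pauli b = sgn (om a b) • (pauli b * pauli a) := by
  fin_cases a <;> fin_cases b <;>
    (ext i j; fin_cases i <;> fin_cases j <;> simp [pauli, om, sgn])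

lemma pauli_mul_self (a : Fin 4) : pauli a * pauli a = 1 := by
  fin_cases a <;> (ext i j; fin_cases i <;> fin_cases j <;> simp [pauli])

lemma pauli_conjTranspose (a : Fin 4) : (pauli a)ᴴ = pauli a := by
  fin_cases a <;> (ext i j; fin_cases i <;> fin_cases j <;> simp [pauli])

lemma trace_pauli_mul (a b : Fin 4) :
    (pauli a * pauli b).trace = if a = b then 2 else 0 := by
  fin_cases a <;> fin_cases b <;> simp [pauli, Matrix.trace_fin_two] <;> norm_num

lemma sum_pauli_mul (s t u v : Fin 2) :
    ∑ a, pauli a s t * pauli a u v = if s = v ∧ t = u then 2 else 0 := by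
  fin_cases s <;> fin_cases t <;> fin_cases u <;> fin_cases v <;>
    simp [pauli, Fin.sum_univ_four] <;> norm_num

section Register

variable {ι : Type} [Fintype ι] [DecidableEq ι]

/-- The symplectic form on Pauli labels: `0` for commuting strings, `1` for anticommuting ones. -/
def symp (P Q : ι → Fin 4) : ZMod 2 := ∑ i, om (P i) (Q i)

lemma symp_comm (P Q : ι → Fin 4) : symp P Q = symp Q P := by
  simp only [symp, om_comm]

/-- The product of Pauli strings up to phase. -/
def mulString (P Q : ι → Fin 4) : ι → Fin 4 := fun i => mulLabel (P i) (Q i)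

lemma symp_mulString (P Q R : ι → Fin 4) : symp P (mulString Q R) = symp P Q + symp P R := by
  simp only [symp, mulString, om_mulLabel, Finset.sum_add_distrib]

lemma symp_single (P : ι → Fin 4) (i : ι) (a : Fin 4) : symp P (Pi.single i a) = om (P i) a := by
  rw [symp, Finset.sum_eq_single i]
  · simp
  · intro j _ hj
    simp [om, Pi.single_eq_of_ne hj]
  · simp

lemma pauliString_eq_tensor (P : ι → Fin 4) : pauliString P = tensor fun i => pauli (P i) := rfl

@[simp] lemma pauliString_zero : pauliString (0 : ι → Fin 4) = 1 := by
  rw [pauliString_eq_tensor, ← tensor_one]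
  rfl

lemma pauliString_mul (P Q : ι → Fin 4) :
    ∃ c : ℂ, pauliString P * pauliString Q = c • pauliString (mulString P Q) := by
  choose c hc using pauli_mul
  refine ⟨∏ i, c (P i) (Q i), ?_⟩
  simp only [pauliString_eq_tensor, tensor_mul, hc, tensor_smul, mulString]

lemma pauliString_mul_comm (P Q : ι → Fin 4) :
    pauliString P * pauliString Q = sgn (symp P Q) • (pauliString Q * pauliString P) := by
  simp only [pauliString_eq_tensor, tensor_mul, symp, sgn_sum, ← tensor_smul]
  congr 1
  funext i
  exact pauli_mul_comm _ _

@[simp] lemma pauliString_mul_self (P : ι → Fin 4) : pauliString P * pauliString P = 1 := by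
  simp only [pauliString_eq_tensor, tensor_mul, pauli_mul_self, tensor_one]

@[simp] lemma pauliString_conjTranspose (P : ι → Fin 4) : (pauliString P)ᴴ = pauliString P := by
  simp only [pauliString_eq_tensor, tensor_conjTranspose, pauli_conjTranspose]

lemma trace_pauliString_mul (P Q : ι → Fin 4) :
    (pauliString P * pauliString Q).trace = if P = Q then 2 ^ Fintype.card ι else 0 := by
  simp only [pauliString_eq_tensor, tensor_mul, trace_tensor, trace_pauli_mul,
    Finset.prod_ite_zero, funext_iff, Finset.mem_univ, true_imp_iff, Finset.prod_const,
    Finset.card_univ]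

lemma sum_pauliString_mul (s t u v : Bits ι) :
    ∑ P : ι → Fin 4, pauliString P s t * pauliString P u v =
      if s = v ∧ t = u then 2 ^ Fintype.card ι else 0 := by
  simp only [pauliString, Matrix.of_apply, ← Finset.prod_mul_distrib]
  have h := Finset.prod_univ_sum (fun _ : ι => (Finset.univ : Finset (Fin 4)))
    (fun i a => pauli a (s i) (t i) * pauli a (u i) (v i))
  rw [Fintype.piFinset_univ] at h
  rw [← h]
  simp only [sum_pauli_mul, Finset.prod_ite_zero, funext_iff, Finset.mem_univ, true_imp_iff,
    Finset.prod_const, Finset.card_univ, forall_and]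

/-- Pauli strings form an orthogonal basis of the operators for the trace inner product. -/
lemma pauli_expansion (A : Op ι) :
    A = ∑ P : ι → Fin 4, ((pauliString P * A).trace / 2 ^ Fintype.card ι) • pauliString P := by
  ext s t
  have h2 : (2 : ℂ) ^ Fintype.card ι ≠ 0 := by positivity
  have h : ∀ P : ι → Fin 4, ((pauliString P * A).trace / 2 ^ Fintype.card ι) * pauliString P s t =
      ∑ u, ∑ v, A v u * (pauliString P s t * pauliString P u v) / 2 ^ Fintype.card ι := by
    intro P
    simp only [Matrix.trace, Matrix.diag, Matrix.mul_apply, Finset.sum_div, Finset.sum_mul]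
    refine Finset.sum_congr rfl fun u _ => Finset.sum_congr rfl fun v _ => ?_
    ring
  simp only [Matrix.sum_apply, Matrix.smul_apply, smul_eq_mul, h]
  rw [Finset.sum_comm]
  have h' : ∀ u v : Bits ι, ∑ P : ι → Fin 4,
      A v u * (pauliString P s t * pauliString P u v) / 2 ^ Fintype.card ι =
        if s = v ∧ t = u then A v u else 0 := by
    intro u v
    rw [← Finset.sum_div, ← Finset.mul_sum, sum_pauliString_mul]
    split_ifs
    · field_simp
    · simp
  calc A s t = ∑ u, ∑ v, if s = v ∧ t = u then A v u else 0 := by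
        simp [ite_and, Finset.sum_ite_eq]
    _ = _ := by
        refine Finset.sum_congr rfl fun u _ => ?_
        rw [Finset.sum_comm]
        exact Finset.sum_congr rfl fun v _ => (h' u v).symm

lemma eq_of_pauliString_eq_smul {P Q : ι → Fin 4} {c : ℂ}
    (h : pauliString P = c • pauliString Q) : P = Q := by
  by_contra hPQ
  have h1 := trace_pauliString_mul P P
  have h2 := trace_pauliString_mul P Q
  rw [if_neg hPQ] at h2
  nth_rewrite 2 [h] at h1
  rw [Matrix.mul_smul, Matrix.trace_smul, h2, smul_zero, if_pos rfl] at h1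
  exact pow_ne_zero _ two_ne_zero h1.symm

/-- Labels of the strings of `I`s and `Z`s. -/
def ZType (P : ι → Fin 4) : Prop := ∀ i, P i = 0 ∨ P i = 3

lemma zType_single (i : ι) : ZType (Pi.single i 3 : ι → Fin 4) := by
  intro j
  by_cases h : j = i
  · subst h; simp
  · simp [Pi.single_eq_of_ne h]

lemma pauliString_offDiag {P : ι → Fin 4} (hP : ZType P) {s t : Bits ι} (hst : s ≠ t) :
    pauliString P s t = 0 := by
  obtain ⟨i, hi⟩ := Function.ne_iff.mp hst
  refine Finset.prod_eq_zero (Finset.mem_univ i) ?_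
  have key : ∀ a b : Fin 2, a ≠ b → pauli 0 a b = 0 ∧ pauli 3 a b = 0 := by
    intro a b
    fin_cases a <;> fin_cases b <;> simp [pauli]
  rcases hP i with h | h <;> rw [h]
  · exact (key _ _ hi).1
  · exact (key _ _ hi).2

lemma pauliString_diag_eq_zero {P : ι → Fin 4} (hP : ¬ ZType P) (s : Bits ι) :
    pauliString P s s = 0 := by
  simp only [ZType, not_forall, not_or] at hP
  obtain ⟨i, h0, h3⟩ := hP
  refine Finset.prod_eq_zero (Finset.mem_univ i) ?_
  generalize P i = a at *
  generalize s i = b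
  fin_cases a <;> fin_cases b <;> simp_all [pauli]

lemma norm_pauliString_le (P : ι → Fin 4) (s t : Bits ι) : ‖pauliString P s t‖ ≤ 1 := by
  simp only [pauliString, Matrix.of_apply, norm_prod]
  refine Finset.prod_le_one (fun _ _ => norm_nonneg _) fun i _ => ?_
  generalize P i = a
  generalize s i = b
  generalize t i = c
  fin_cases a <;> fin_cases b <;> fin_cases c <;> simp [pauli]

lemma pauliString_single_diag (i : ι) (s : Bits ι) :
    pauliString (Pi.single i 3) s s = if s i = 0 then 1 else -1 := by
  simp only [pauliString, Matrix.of_apply]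
  rw [Finset.prod_eq_single i]
  · simp only [Pi.single_eq_same]
    generalize s i = b
    fin_cases b <;> simp [pauli]
  · intro j _ hj
    simp [Pi.single_eq_of_ne hj, pauli]
  · simp

lemma trace_mul_single (A : Op ι) (b : Bits ι) : (A * Matrix.single b b 1).trace = A b b := by
  rw [Matrix.trace_mul_comm, Matrix.trace_single_mul]
  simp

/-- The expansion of a computational basis projection. -/
lemma single_expansion (b : Bits ι) :
    (Matrix.single b b 1 : Op ι) =
      ∑ P : ι → Fin 4, (pauliString P b b / 2 ^ Fintype.card ι) • pauliString P := by
  conv_lhs => rw [pauli_expansion (Matrix.single b b 1 : Op ι)]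
  simp only [trace_mul_single]

lemma IsSignedZString.zType_of_eq {A : Op ι} {P : ι → Fin 4} {c : ℂ} (hc : c ≠ 0)
    (hA : A = c • pauliString P) : IsSignedZString A → ZType P := by
  rintro ⟨Q, hQ, h⟩
  have : P = Q := by
    rcases h with h | h
    · refine eq_of_pauliString_eq_smul (c := c⁻¹) ?_
      rw [← h, hA, smul_smul, inv_mul_cancel₀ hc, one_smul]
    · refine eq_of_pauliString_eq_smul (c := -c⁻¹) ?_
      rw [neg_smul, ← smul_neg, ← h, hA, smul_smul, inv_mul_cancel₀ hc, one_smul]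
  exact this ▸ hQ

end Register

/-! ### The action of Clifford unitaries on Pauli labels -/

section Clifford

variable {ι : Type} [Fintype ι] [DecidableEq ι]

/-- Conjugation by `A` sends the Pauli string `P` to a multiple of the string `Q`. -/
def Maps (A : Op ι) (P Q : ι → Fin 4) : Prop :=
  ∃ c : ℂ, A * pauliString P * Aᴴ = c • pauliString Q

lemma Maps.comp {A B : Op ι} {P Q R : ι → Fin 4} (hA : Maps A P Q) (hB : Maps B Q R) :
    Maps (B * A) P R := by
  obtain ⟨c, hc⟩ := hA
  obtain ⟨d, hd⟩ := hB
  refine ⟨c * d, ?_⟩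
  calc B * A * pauliString P * (B * A)ᴴ = B * (A * pauliString P * Aᴴ) * Bᴴ := by
        simp only [Matrix.conjTranspose_mul, Matrix.mul_assoc]
    _ = (c * d) • pauliString R := by
        rw [hc, Matrix.mul_smul, Matrix.smul_mul, hd, smul_smul]

lemma maps_one (P : ι → Fin 4) : Maps 1 P P := ⟨1, by simp⟩

lemma mem_unitaryGroup_iff_and {A : Op ι} :
    A ∈ Matrix.unitaryGroup (Bits ι) ℂ ↔ A * Aᴴ = 1 ∧ Aᴴ * A = 1 := by
  constructor
  · intro h
    exact ⟨Matrix.mem_unitaryGroup_iff.mp h, Matrix.mem_unitaryGroup_iff'.mp h⟩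
  · intro h
    exact Matrix.mem_unitaryGroup_iff.mpr h.1

lemma conj_mul_conj {A : Op ι} (hA : Aᴴ * A = 1) (X Y : Op ι) :
    (A * X * Aᴴ) * (A * Y * Aᴴ) = A * (X * Y) * Aᴴ := by
  calc (A * X * Aᴴ) * (A * Y * Aᴴ) = A * X * (Aᴴ * A) * Y * Aᴴ := by
        simp only [Matrix.mul_assoc]
    _ = A * (X * Y) * Aᴴ := by rw [hA]; simp only [Matrix.mul_assoc, Matrix.one_mul]

/-- Since Pauli strings are involutions, the factor in `Maps` is a sign. -/
lemma Maps.eq_or_neg {A : Op ι} (hA : A ∈ Matrix.unitaryGroup (Bits ι) ℂ) {P Q : ι → Fin 4}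
    (h : Maps A P Q) :
    A * pauliString P * Aᴴ = pauliString Q ∨ A * pauliString P * Aᴴ = -pauliString Q := by
  obtain ⟨h1, h2⟩ := mem_unitaryGroup_iff_and.mp hA
  obtain ⟨c, hc⟩ := h
  have h3 : (c * c) • (1 : Op ι) = 1 := by
    have := conj_mul_conj h2 (pauliString P) (pauliString P)
    rw [hc, pauliString_mul_self, Matrix.mul_one, h1, Matrix.smul_mul, Matrix.mul_smul,
      pauliString_mul_self, smul_smul] at this
    exact this
  have h4 : c * c = 1 := by
    have := congrFun (congrFun h3 0) 0
    simpa using this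
  rcases mul_self_eq_one_iff.mp h4 with rfl | rfl
  · left; rw [hc, one_smul]
  · right; rw [hc, neg_one_smul]

lemma isClifford_of_maps {A : Op ι} (hA : A ∈ Matrix.unitaryGroup (Bits ι) ℂ)
    (h : ∀ P, ∃ Q, Maps A P Q) : IsClifford A :=
  ⟨hA, fun P => (h P).imp fun _ hQ => hQ.eq_or_neg hA⟩

lemma IsClifford.exists_maps {A : Op ι} (hA : IsClifford A) (P : ι → Fin 4) : ∃ Q, Maps A P Q := by
  obtain ⟨Q, h | h⟩ := hA.2 P
  · exact ⟨Q, 1, by rw [h, one_smul]⟩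
  · exact ⟨Q, -1, by rw [h, neg_one_smul]⟩

lemma IsClifford.mul_conjTranspose {A : Op ι} (hA : IsClifford A) : A * Aᴴ = 1 :=
  (mem_unitaryGroup_iff_and.mp hA.1).1

lemma IsClifford.conjTranspose_mul {A : Op ι} (hA : IsClifford A) : Aᴴ * A = 1 :=
  (mem_unitaryGroup_iff_and.mp hA.1).2

lemma isClifford_one : IsClifford (1 : Op ι) :=
  isClifford_of_maps (one_mem _) fun P => ⟨P, maps_one P⟩

lemma IsClifford.mul {A B : Op ι} (hA : IsClifford A) (hB : IsClifford B) : IsClifford (A * B) := by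
  refine isClifford_of_maps (mul_mem hA.1 hB.1) fun P => ?_
  obtain ⟨Q, hQ⟩ := hB.exists_maps P
  obtain ⟨R, hR⟩ := hA.exists_maps Q
  exact ⟨R, hQ.comp hR⟩

lemma Maps.right_unique {A : Op ι} (hA : IsClifford A) {P Q Q' : ι → Fin 4} (h : Maps A P Q)
    (h' : Maps A P Q') : Q = Q' := by
  obtain ⟨c, hc⟩ := h'
  rcases h.eq_or_neg hA.1 with h | h
  · exact eq_of_pauliString_eq_smul (h.symm.trans hc)
  · refine eq_of_pauliString_eq_smul (c := -c) ?_
    rw [neg_smul, ← hc, h, neg_neg]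

lemma IsClifford.conj_cancel {A : Op ι} (hA : IsClifford A) (X : Op ι) :
    Aᴴ * (A * X * Aᴴ) * A = X := by
  calc Aᴴ * (A * X * Aᴴ) * A = (Aᴴ * A) * X * (Aᴴ * A) := by simp only [Matrix.mul_assoc]
    _ = X := by rw [hA.conjTranspose_mul, Matrix.one_mul, Matrix.mul_one]

lemma Maps.left_unique {A : Op ι} (hA : IsClifford A) {P P' Q : ι → Fin 4} (h : Maps A P Q)
    (h' : Maps A P' Q) : P = P' := by
  have key : ∀ R, Maps A R Q →
      pauliString R = Aᴴ * pauliString Q * A ∨ pauliString R = -(Aᴴ * pauliString Q * A) := by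
    intro R hR
    rcases hR.eq_or_neg hA.1 with h | h
    · left; rw [← h, hA.conj_cancel]
    · right
      rw [← neg_eq_iff_eq_neg] at h
      rw [← h, Matrix.mul_neg, Matrix.neg_mul, neg_neg, hA.conj_cancel]
  have : pauliString P = (1 : ℂ) • pauliString P' ∨ pauliString P = (-1 : ℂ) • pauliString P' := by
    rw [one_smul, neg_one_smul]
    rcases key P h with h | h <;> rcases key P' h' with h' | h' <;> rw [h, h'] <;> simp
  rcases this with h | h <;> exact eq_of_pauliString_eq_smul h

/-- A Clifford unitary permutes the Pauli labels. -/
lemma IsClifford.exists_perm {A : Op ι} (hA : IsClifford A) :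
    ∃ e : Equiv.Perm (ι → Fin 4), ∀ P, Maps A P (e P) := by
  choose f hf using hA.exists_maps
  have hinj : Function.Injective f := fun P P' h => Maps.left_unique hA (hf P) (h ▸ hf P')
  exact ⟨Equiv.ofBijective f (Finite.injective_iff_bijective.mp hinj), hf⟩

/-- The permutation of the Pauli labels induced by a Clifford unitary. -/
def IsClifford.act {A : Op ι} (hA : IsClifford A) : Equiv.Perm (ι → Fin 4) :=
  hA.exists_perm.choose

lemma IsClifford.maps_act {A : Op ι} (hA : IsClifford A) (P : ι → Fin 4) : Maps A P (hA.act P) :=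
  hA.exists_perm.choose_spec P

lemma IsClifford.act_eq {A : Op ι} (hA : IsClifford A) {P Q : ι → Fin 4} (h : Maps A P Q) :
    hA.act P = Q := Maps.right_unique hA (hA.maps_act P) h

lemma IsClifford.act_zero {A : Op ι} (hA : IsClifford A) : hA.act 0 = 0 :=
  hA.act_eq ⟨1, by simp [hA.mul_conjTranspose]⟩

lemma Maps.symp_eq {A : Op ι} (hA : IsClifford A) {P P' Q Q' : ι → Fin 4} (h : Maps A P Q)
    (h' : Maps A P' Q') : symp Q Q' = symp P P' := by
  obtain ⟨c, hc⟩ := h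
  obtain ⟨c', hc'⟩ := h'
  have h1 : A * (pauliString P * pauliString P') * Aᴴ =
      sgn (symp Q Q') • (A * (pauliString P' * pauliString P) * Aᴴ) := by
    rw [← conj_mul_conj hA.conjTranspose_mul, ← conj_mul_conj hA.conjTranspose_mul, hc, hc',
      Matrix.smul_mul, Matrix.mul_smul, Matrix.smul_mul, Matrix.mul_smul, pauliString_mul_comm Q Q',
      smul_comm c c', smul_comm c (sgn _), smul_comm c' (sgn _)]
  have h2 : pauliString P * pauliString P' =
      sgn (symp Q Q') • (pauliString P' * pauliString P) := by
    have := congrArg (fun X => Aᴴ * X * A) h1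
    simpa only [Matrix.mul_smul, Matrix.smul_mul, hA.conj_cancel] using this
  rw [pauliString_mul_comm P P'] at h2
  have h3 := congrArg (fun X => X * (pauliString P * pauliString P')) h2
  have h4 : pauliString P' * pauliString P * (pauliString P * pauliString P') = 1 := by
    rw [Matrix.mul_assoc, ← Matrix.mul_assoc (pauliString P) (pauliString P),
      pauliString_mul_self, Matrix.one_mul, pauliString_mul_self]
  simp only [Matrix.smul_mul, h4] at h3
  have h5 := congrFun (congrFun h3 0) 0
  simp only [Matrix.smul_apply, Matrix.one_apply_eq, smul_eq_mul, mul_one] at h5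
  exact (sgn_injective h5).symm

lemma isSignedZString_conj_iff {A : Op ι} (hA : IsClifford A) (P : ι → Fin 4) :
    IsSignedZString (A * pauliString P * Aᴴ) ↔ ZType (hA.act P) := by
  rcases (hA.maps_act P).eq_or_neg hA.1 with h | h
  · exact ⟨IsSignedZString.zType_of_eq (c := 1) one_ne_zero (by rw [h, one_smul]),
      fun hZ => ⟨_, hZ, Or.inl h⟩⟩
  · exact ⟨IsSignedZString.zType_of_eq (c := -1) (by norm_num) (by rw [h, neg_one_smul]),
      fun hZ => ⟨_, hZ, Or.inr h⟩⟩

/-! ### Transvections -/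

/-- For anticommuting Pauli strings `P` and `R`, the operator `(P + R) / √2` is a Clifford
unitary that exchanges `P` and `R`. -/
def transvection (P R : ι → Fin 4) : Op ι :=
  ((√2 : ℝ) : ℂ)⁻¹ • (pauliString P + pauliString R)

lemma transvection_conjTranspose (P R : ι → Fin 4) :
    (transvection P R)ᴴ = transvection P R := by
  simp [transvection, Matrix.conjTranspose_smul]

lemma transvection_conj (P R : ι → Fin 4) (X : Op ι) :
    transvection P R * X * (transvection P R)ᴴ =
      (2 : ℂ)⁻¹ • ((pauliString P + pauliString R) * X * (pauliString P + pauliString R)) := by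
  rw [transvection_conjTranspose]
  simp only [transvection, Matrix.smul_mul, Matrix.mul_smul, smul_smul]
  congr 1
  rw [← mul_inv, ← Complex.ofReal_mul, Real.mul_self_sqrt (by norm_num)]
  norm_num

lemma pauliString_anticomm {P R : ι → Fin 4} (h : symp P R = 1) :
    pauliString P * pauliString R = -(pauliString R * pauliString P) := by
  rw [pauliString_mul_comm, h, sgn_one, neg_one_smul]

lemma pauliString_comm {P R : ι → Fin 4} (h : symp P R = 0) :
    pauliString P * pauliString R = pauliString R * pauliString P := by
  rw [pauliString_mul_comm, h, sgn_zero, one_smul]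

lemma transvection_mem {P R : ι → Fin 4} (h : symp P R = 1) :
    transvection P R ∈ Matrix.unitaryGroup (Bits ι) ℂ := by
  rw [Matrix.mem_unitaryGroup_iff]
  have := transvection_conj P R 1
  rw [Matrix.mul_one] at this
  refine this.trans ?_
  simp only [Matrix.mul_one, Matrix.add_mul, Matrix.mul_add, pauliString_mul_self,
    pauliString_anticomm h]
  ext s t
  simp only [Matrix.smul_apply, Matrix.add_apply, Matrix.neg_apply, smul_eq_mul]
  ring

lemma transvection_maps {P R : ι → Fin 4} (h : symp P R = 1) : Maps (transvection P R) P R := by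
  refine ⟨1, ?_⟩
  rw [transvection_conj]
  have h1 : pauliString R * pauliString P * pauliString R = -pauliString P := by
    rw [Matrix.mul_assoc, pauliString_anticomm h, Matrix.mul_neg, ← Matrix.mul_assoc,
      pauliString_mul_self, Matrix.one_mul]
  have h2 : (pauliString P + pauliString R) * pauliString P * (pauliString P + pauliString R) =
      (2 : ℂ) • pauliString R := by
    simp only [Matrix.add_mul, Matrix.mul_add, pauliString_mul_self, Matrix.one_mul, h1]
    rw [Matrix.mul_assoc (pauliString R), pauliString_mul_self, Matrix.mul_one, two_smul]
    abel
  rw [h2, smul_smul, one_smul]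
  norm_num

lemma transvection_isClifford {P R : ι → Fin 4} (h : symp P R = 1) :
    IsClifford (transvection P R) := by
  refine isClifford_of_maps (transvection_mem h) fun X => ?_
  have h0 := transvection_mem h
  rw [Matrix.mem_unitaryGroup_iff] at h0
  have h0' : transvection P R * (transvection P R)ᴴ = 1 := h0
  have h01 : ∀ a : ZMod 2, a = 0 ∨ a = 1 := by decide
  have hPR := pauliString_anticomm h
  -- if `X` anticommutes with one of the two strings only, it is sent to a multiple of `X * P * R`
  have key : ∀ Y Z : ι → Fin 4, pauliString Y * pauliString Z = -(pauliString Z * pauliString Y) →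
      symp X Y = 0 → symp X Z = 1 →
      (pauliString Y + pauliString Z) * pauliString X * (pauliString Y + pauliString Z) =
        (2 : ℂ) • (pauliString X * (pauliString Y * pauliString Z)) := by
    intro Y Z hYZ hY hZ
    rw [Matrix.add_mul, ← pauliString_comm hY, ← neg_eq_iff_eq_neg.mpr (pauliString_anticomm hZ),
      ← sub_eq_add_neg, ← Matrix.mul_sub, Matrix.mul_assoc]
    simp only [Matrix.sub_mul, Matrix.mul_add, pauliString_mul_self, hYZ, two_smul]
    simp only [← Matrix.mul_add]
    congr 1
    rw [← neg_eq_iff_eq_neg.mpr hYZ]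
    abel
  have key2 : ∀ Y Z : ι → Fin 4, ∃ Q, ∃ c : ℂ,
      pauliString X * (pauliString Y * pauliString Z) = c • pauliString Q := by
    intro Y Z
    obtain ⟨c, hc⟩ := pauliString_mul Y Z
    obtain ⟨d, hd⟩ := pauliString_mul X (mulString Y Z)
    exact ⟨_, c * d, by rw [hc, Matrix.mul_smul, hd, smul_smul]⟩
  rcases h01 (symp X P) with hP | hP <;> rcases h01 (symp X R) with hR | hR
  · refine ⟨X, 1, ?_⟩
    have : transvection P R * pauliString X = pauliString X * transvection P R := by
      simp only [transvection, Matrix.smul_mul, Matrix.mul_smul, Matrix.add_mul, Matrix.mul_add,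
        pauliString_comm hP, pauliString_comm hR]
    rw [this, Matrix.mul_assoc, h0', Matrix.mul_one, one_smul]
  · obtain ⟨Q, c, hc⟩ := key2 P R
    exact ⟨Q, (2 : ℂ)⁻¹ * 2 * c, by rw [transvection_conj, key P R hPR hP hR, hc, smul_smul,
      smul_smul]⟩
  · obtain ⟨Q, c, hc⟩ := key2 R P
    refine ⟨Q, (2 : ℂ)⁻¹ * 2 * c, ?_⟩
    rw [transvection_conj, add_comm (pauliString P), key R P (by rw [hPR, neg_neg]) hR hP, hc,
      smul_smul, smul_smul]
  · refine ⟨X, -1, ?_⟩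
    have : transvection P R * pauliString X = -(pauliString X * transvection P R) := by
      simp only [transvection, Matrix.smul_mul, Matrix.mul_smul, Matrix.add_mul, Matrix.mul_add,
        pauliString_anticomm hP, pauliString_anticomm hR, ← smul_neg, neg_add, neg_neg]
    rw [this, Matrix.neg_mul, Matrix.mul_assoc, h0', Matrix.mul_one, neg_one_smul]

/-- Every nontrivial Pauli string is sent to a single `Z` by some Clifford unitary: two strings
that commute are exchanged by way of a third string that anticommutes with both. -/
lemma exists_clifford_maps_single (P : ι → Fin 4) (hP : P ≠ 0) (t : ι) :
    ∃ A : Op ι, IsClifford A ∧ Maps A P (Pi.single t 3) := by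
  have key : ∃ T : ι → Fin 4, symp P T = 1 ∧ symp T (Pi.single t 3) = 1 := by
    by_cases ht : P t = 0
    · obtain ⟨i, hi⟩ := Function.ne_iff.mp hP
      obtain ⟨b, hb⟩ := exists_om_eq_one (P i) hi
      have hit : i ≠ t := fun h => hi (h ▸ ht)
      refine ⟨mulString (Pi.single i b) (Pi.single t 1), ?_, ?_⟩
      · rw [symp_mulString, symp_single, symp_single, hb, ht]
        rfl
      · rw [symp_comm, symp_mulString, symp_single, symp_single, Pi.single_eq_same,
          Pi.single_eq_of_ne hit]
        simp only [om, true_or, if_true, zero_add]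
        rfl
    · obtain ⟨b, hb, hb'⟩ : ∃ b, om (P t) b = 1 ∧ om b 3 = 1 := by
        generalize P t = a at ht
        revert a; decide
      exact ⟨Pi.single t b, by rw [symp_single, hb], by rw [symp_single, Pi.single_eq_same, hb']⟩
  obtain ⟨T, h1, h2⟩ := key
  exact ⟨transvection T (Pi.single t 3) * transvection P T,
    (transvection_isClifford h2).mul (transvection_isClifford h1),
    (transvection_maps h1).comp (transvection_maps h2)⟩

end Clifford

/-! ### Operators on part of the register -/

section Embed

variable {ι : Type} [Fintype ι] [DecidableEq ι]

open scoped Classical in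
/-- The operator on the register `ι` that acts as `A` on the sites in `S` and as the identity
elsewhere. -/
def embed (S : Finset ι) (A : Op S) : Op ι :=
  Matrix.of fun s t => if ∀ q, q ∉ S → s q = t q then A (fun q => s q) (fun q => t q) else 0

/-- The label that agrees with `P` on `S` and is trivial elsewhere. -/
def extend (S : Finset ι) (P : S → Fin 4) : ι → Fin 4 :=
  fun i => if h : i ∈ S then P ⟨i, h⟩ else 0

lemma embed_tensor (S : Finset ι) (A : S → Matrix (Fin 2) (Fin 2) ℂ) :
    embed S (tensor A) = tensor fun i : ι => if h : i ∈ S then A ⟨i, h⟩ else 1 := by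
  ext s t
  simp only [embed, tensor, Matrix.of_apply]
  rw [← Finset.prod_mul_prod_compl S, ← Finset.prod_coe_sort S]
  have h1 : ∏ i : S, (if h : (i : ι) ∈ S then A ⟨i, h⟩ else 1) (s i) (t i) =
      ∏ i : S, A i (s i) (t i) := by
    refine Finset.prod_congr rfl fun i _ => ?_
    rw [dif_pos i.2]
  have h2 : ∏ i ∈ Sᶜ, (if h : i ∈ S then A ⟨i, h⟩ else 1) (s i) (t i) =
      if ∀ q, q ∉ S → s q = t q then 1 else 0 := by
    have : ∀ i ∈ Sᶜ, (if h : i ∈ S then A ⟨i, h⟩ else 1) (s i) (t i) =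
        if s i = t i then 1 else 0 := fun i hi => by
      rw [dif_neg (Finset.mem_compl.mp hi), Matrix.one_apply]
    simp only [Finset.prod_congr rfl this, Finset.prod_ite_zero, Finset.prod_const_one,
      Finset.mem_compl]
  rw [h1, h2]
  split_ifs <;> simp

lemma embed_pauliString (S : Finset ι) (P : S → Fin 4) :
    embed S (pauliString P) = pauliString (extend S P) := by
  rw [pauliString_eq_tensor, embed_tensor, pauliString_eq_tensor]
  congr 1
  funext i
  simp only [extend]
  split_ifs
  · rfl
  · rfl

/-- `embed` as a linear map. -/
def embedLin (S : Finset ι) : Op S →ₗ[ℂ] Op ι where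
  toFun := embed S
  map_add' A B := by
    ext s t
    simp only [embed, Matrix.of_apply, Matrix.add_apply]
    split_ifs <;> simp
  map_smul' c A := by
    ext s t
    simp only [embed, Matrix.of_apply, Matrix.smul_apply, RingHom.id_apply]
    split_ifs <;> simp

/-- An additive property of operators follows from the case of Pauli strings. -/
lemma pauli_induction {p : Op ι → Prop} (A : Op ι) (hsum : ∀ A B, p A → p B → p (A + B))
    (hzero : p 0) (hpauli : ∀ (c : ℂ) P, p (c • pauliString P)) : p A := by
  rw [pauli_expansion A]
  exact Finset.sum_induction _ p hsum hzero fun P _ => hpauli _ P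

lemma embed_add (S : Finset ι) (A B : Op S) : embed S (A + B) = embed S A + embed S B :=
  (embedLin S).map_add A B

lemma embed_smul (S : Finset ι) (c : ℂ) (A : Op S) : embed S (c • A) = c • embed S A :=
  (embedLin S).map_smul c A

@[simp] lemma embed_zero (S : Finset ι) : embed S (0 : Op S) = 0 := (embedLin S).map_zero

lemma embed_mul (S : Finset ι) (A B : Op S) : embed S (A * B) = embed S A * embed S B := by
  refine pauli_induction (p := fun A => embed S (A * B) = embed S A * embed S B) A ?_ ?_ ?_
  · intro A A' h h'
    rw [Matrix.add_mul, embed_add, h, h', embed_add, Matrix.add_mul]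
  · simp
  · intro c P
    refine pauli_induction (p := fun B => embed S ((c • pauliString P) * B) = _ * embed S B) B
      ?_ ?_ ?_
    · intro A A' h h'
      rw [Matrix.mul_add, embed_add, h, h', embed_add, Matrix.mul_add]
    · simp
    · intro d Q
      simp only [embed_smul, Matrix.smul_mul, Matrix.mul_smul]
      congr 2
      simp only [pauliString_eq_tensor, tensor_mul, embed_tensor]
      congr 1
      funext i
      split_ifs <;> simp

@[simp] lemma embed_one (S : Finset ι) : embed S (1 : Op S) = 1 := by
  rw [← tensor_one, embed_tensor, ← tensor_one]
  congr 1
  funext i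
  split_ifs <;> rfl

lemma embed_conjTranspose (S : Finset ι) (A : Op S) : (embed S A)ᴴ = embed S Aᴴ := by
  ext s t
  simp only [embed, Matrix.of_apply, Matrix.conjTranspose_apply]
  have : (∀ q, q ∉ S → t q = s q) ↔ (∀ q, q ∉ S → s q = t q) :=
    forall₂_congr fun _ _ => eq_comm
  simp only [this]
  split_ifs <;> simp

lemma symp_eq_zero_of_disjoint {P Q : ι → Fin 4} (h : ∀ i, P i = 0 ∨ Q i = 0) : symp P Q = 0 := by
  refine Finset.sum_eq_zero fun i _ => ?_
  rcases h i with h | h <;> simp [om, h]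

lemma embed_comm_pauliString (S : Finset ι) (A : Op S) {P : ι → Fin 4} (hP : ∀ i ∈ S, P i = 0) :
    embed S A * pauliString P = pauliString P * embed S A := by
  refine pauli_induction (p := fun A => embed S A * pauliString P = pauliString P * embed S A) A
    ?_ ?_ ?_
  · intro A B hA hB
    rw [embed_add, Matrix.add_mul, hA, hB, Matrix.mul_add]
  · simp
  · intro c Q
    rw [embed_smul, embed_pauliString, Matrix.smul_mul, Matrix.mul_smul, pauliString_comm]
    refine symp_eq_zero_of_disjoint fun i => ?_
    by_cases h : i ∈ S
    · exact Or.inr (hP i h)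
    · exact Or.inl (dif_neg h)

lemma embed_comm {S T : Finset ι} (h : Disjoint S T) (A : Op S) (B : Op T) :
    embed S A * embed T B = embed T B * embed S A := by
  refine pauli_induction (p := fun B => embed S A * embed T B = embed T B * embed S A) B
    ?_ ?_ ?_
  · intro B B' hB hB'
    rw [embed_add, Matrix.mul_add, hB, hB', Matrix.add_mul]
  · simp
  · intro c Q
    rw [embed_smul, embed_pauliString, Matrix.smul_mul, Matrix.mul_smul,
      embed_comm_pauliString S A fun i hi => dif_neg (Finset.disjoint_left.mp h hi)]

/-- The label that equals `Q` on `S` and `P` elsewhere. -/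
def replaceOn (S : Finset ι) (P : ι → Fin 4) (Q : S → Fin 4) : ι → Fin 4 :=
  fun i => if h : i ∈ S then Q ⟨i, h⟩ else P i

lemma pauliString_replaceOn (S : Finset ι) (P : ι → Fin 4) (Q : S → Fin 4) :
    pauliString (replaceOn S P Q) = pauliString (extend S Q) * pauliString (replaceOn S P 0) := by
  simp only [pauliString_eq_tensor, tensor_mul]
  congr 1
  funext i
  by_cases h : i ∈ S
  · simp [replaceOn, extend, h, pauli]
  · simp [replaceOn, extend, h, pauli]

lemma embed_mem {S : Finset ι} {A : Op S} (hA : A ∈ Matrix.unitaryGroup (Bits S) ℂ) :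
    embed S A ∈ Matrix.unitaryGroup (Bits ι) ℂ := by
  rw [mem_unitaryGroup_iff_and] at hA ⊢
  rw [embed_conjTranspose, ← embed_mul, ← embed_mul, hA.1, hA.2, embed_one]
  exact ⟨rfl, rfl⟩

lemma embed_maps {S : Finset ι} {A : Op S} (hA : A ∈ Matrix.unitaryGroup (Bits S) ℂ)
    {P : ι → Fin 4} {Q : S → Fin 4} (h : Maps A (fun i => P i) Q) :
    Maps (embed S A) P (replaceOn S P Q) := by
  obtain ⟨c, hc⟩ := h
  have hP : P = replaceOn S P (fun i => P i) := by
    funext i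
    simp [replaceOn]
  have hone : embed S A * embed S Aᴴ = 1 := by
    rw [← embed_mul, (mem_unitaryGroup_iff_and.mp hA).1, embed_one]
  refine ⟨c, ?_⟩
  conv_lhs => rw [hP]
  rw [pauliString_replaceOn, pauliString_replaceOn S P Q, embed_conjTranspose, Matrix.mul_assoc,
    Matrix.mul_assoc, ← embed_comm_pauliString S Aᴴ, ← embed_pauliString, ← embed_pauliString,
    ← Matrix.mul_assoc, ← Matrix.mul_assoc, ← embed_mul, ← embed_mul, hc, embed_smul,
    Matrix.smul_mul]
  intro i hi
  simp [replaceOn, hi]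

lemma embed_isClifford {S : Finset ι} {A : Op S} (hA : IsClifford A) : IsClifford (embed S A) :=
  isClifford_of_maps (embed_mem hA.1) fun P =>
    (hA.exists_maps fun i => P i).elim fun _ hQ => ⟨_, embed_maps hA.1 hQ⟩

/-- The action of `A` on labels does not change them outside `S`, and fixes the labels that are
trivial on `S`. -/
def LocalOn (S : Finset ι) (A : Op ι) : Prop :=
  ∀ P Q, Maps A P Q → (∀ i, i ∉ S → Q i = P i) ∧ ((∀ i ∈ S, P i = 0) → Q = P)

lemma embed_localOn {S : Finset ι} {A : Op S} (hA : IsClifford A) : LocalOn S (embed S A) := by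
  intro P Q hQ
  obtain ⟨R, hR⟩ := hA.exists_maps fun i => P i
  have h := Maps.right_unique (embed_isClifford hA) hQ (embed_maps hA.1 hR)
  refine ⟨fun i hi => ?_, fun hP => ?_⟩
  · rw [h, replaceOn, dif_neg hi]
  · have h0 : (fun i : S => P i) = 0 := funext fun i => hP i i.2
    rw [h0] at hR
    have : R = 0 := Maps.right_unique hA hR ⟨1, by simp [hA.mul_conjTranspose]⟩
    rw [h, this]
    funext i
    by_cases hi : i ∈ S
    · simp [replaceOn, hi, hP i hi]
    · simp [replaceOn, hi]

lemma LocalOn.mono {S T : Finset ι} (h : S ⊆ T) {A : Op ι} (hA : LocalOn S A) : LocalOn T A :=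
  fun P Q hPQ => ⟨fun i hi => (hA P Q hPQ).1 i fun hS => hi (h hS),
    fun hP => (hA P Q hPQ).2 fun i hi => hP i (h hi)⟩

lemma localOn_one (S : Finset ι) : LocalOn S (1 : Op ι) := by
  intro P Q h
  have : Q = P := Maps.right_unique isClifford_one h (maps_one P)
  simp [this]

lemma LocalOn.mul {S : Finset ι} {A B : Op ι} (hA : LocalOn S A) (hB : LocalOn S B)
    (hA' : IsClifford A) (hB' : IsClifford B) : LocalOn S (A * B) := by
  intro P Q h
  obtain ⟨R, hR⟩ := hB'.exists_maps P
  obtain ⟨R', hR'⟩ := hA'.exists_maps R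
  have hQ : Q = R' := Maps.right_unique (hA'.mul hB') h (hR.comp hR')
  subst hQ
  refine ⟨fun i hi => ?_, fun hP => ?_⟩
  · rw [(hA R Q hR').1 i hi, (hB P R hR).1 i hi]
  · have hRP := (hB P R hR).2 hP
    subst hRP
    exact (hA R Q hR').2 hP

/-- A Clifford unitary on the sites in `S` that turns the part of `P` in `S` into `I` or `Z` at
the site `t` and `I` at the other sites. -/
lemma exists_clifford_clear (S : Finset ι) (t : S) (P : ι → Fin 4) :
    ∃ A : Op S, IsClifford A ∧ ∃ Q, Maps (embed S A) P Q ∧ (∀ i, i ∉ S → Q i = P i) ∧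
      (∀ i ∈ S, i ≠ t → Q i = 0) ∧ (Q t = 0 ∨ Q t = 3) := by
  by_cases hP : (fun i : S => P i) = 0
  · have h0 : ∀ i ∈ S, P i = 0 := fun i hi => congrFun hP ⟨i, hi⟩
    exact ⟨1, isClifford_one, P, by rw [embed_one]; exact maps_one P, fun _ _ => rfl,
      fun i hi _ => h0 i hi, Or.inl (h0 t t.2)⟩
  · obtain ⟨A, hA, h⟩ := exists_clifford_maps_single _ hP t
    refine ⟨A, hA, _, embed_maps hA.1 h, fun i hi => by simp [replaceOn, hi], fun i hi hit => ?_, ?_⟩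
    · simp only [replaceOn, hi, dif_pos]
      exact Pi.single_eq_of_ne (fun h => hit (congrArg Subtype.val h)) _
    · right
      simp [replaceOn]

end Embed

/-! ### Diagonalizing commuting Pauli strings -/

section Elimination

variable {ι : Type} [Fintype ι] [DecidableEq ι]

lemma act_mul {A B : Op ι} (hA : IsClifford A) (hB : IsClifford B) (P : ι → Fin 4) :
    (hA.mul hB).act P = hA.act (hB.act P) :=
  (hA.mul hB).act_eq ((hB.maps_act P).comp (hA.maps_act _))

lemma symp_act {A : Op ι} (hA : IsClifford A) (P Q : ι → Fin 4) :
    symp (hA.act P) (hA.act Q) = symp P Q :=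
  Maps.symp_eq hA (hA.maps_act P) (hA.maps_act Q)

/-- The sites `σ p` that are still free after `r` of the `k` elimination steps. -/
def freeSites {k : ℕ} (σ : Fin k → ι) (r : ℕ) : Finset ι :=
  (Finset.univ.filter fun p : Fin k => (p : ℕ) + r < k).image σ

lemma apply_mem_freeSites {k : ℕ} {σ : Fin k → ι} (hσ : Function.Injective σ) {r : ℕ} {p : Fin k} :
    σ p ∈ freeSites σ r ↔ (p : ℕ) + r < k := by
  simp [freeSites, hσ.eq_iff]

lemma freeSites_subset {k : ℕ} (σ : Fin k → ι) (r : ℕ) :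
    freeSites σ r ⊆ Finset.univ.image σ :=
  Finset.image_subset_image (Finset.filter_subset _ _)

/-- Symplectic elimination. The strings `g q` commute, and `h q` anticommutes with `g q` alone, so
that the `g q` are independent. Step `r` brings the image of `g r` into the form `I ⋯ I Z` on
the free sites and thereby uses up the last free site. It is kept invariant that every string which
commutes with the images of the `g q`, `q < r`, consists of `I`s and `Z`s on the sites used up.
The predicate `Good r A` records how `A` is built in `r` steps. -/
theorem exists_diagonalizing {k : ℕ} (σ : Fin k → ι) (hσ : Function.Injective σ)
    (g h : Fin k → ι → Fin 4) (hg : ∀ q i, i ∉ Finset.univ.image σ → g q i = 0)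
    (hgg : ∀ q q', symp (g q) (g q') = 0)
    (hhg : ∀ q q', symp (h q) (g q') = if q = q' then 1 else 0)
    (Good : ℕ → Op ι → Prop) (hgood : Good 0 1)
    (hstep : ∀ r A P, r < k → Good r A → ∃ S, IsClifford S ∧ LocalOn (freeSites σ r) S ∧
      Good (r + 1) (S * A) ∧ ∃ Q, Maps S P Q ∧ (∀ p : Fin k, (p : ℕ) + r + 1 < k → Q (σ p) = 0) ∧
        ∀ p : Fin k, (p : ℕ) + r + 1 = k → Q (σ p) = 0 ∨ Q (σ p) = 3) :
    ∃ A, Good k A ∧ IsClifford A ∧ LocalOn (Finset.univ.image σ) A ∧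
      ∀ q, ∃ Q, Maps A (g q) Q ∧ ZType Q ∧ ∀ i, i ∉ Finset.univ.image σ → Q i = 0 := by
  have main : ∀ r, r ≤ k → ∃ A, ∃ hA : IsClifford A, Good r A ∧
      LocalOn (Finset.univ.image σ) A ∧
      (∀ q : Fin k, (q : ℕ) < r → ∀ p : Fin k, (p : ℕ) + r < k → hA.act (g q) (σ p) = 0) ∧
      (∀ P, (∀ q : Fin k, (q : ℕ) < r → symp P (hA.act (g q)) = 0) →
        ∀ p : Fin k, k ≤ (p : ℕ) + r → P (σ p) = 0 ∨ P (σ p) = 3) := by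
    intro r
    induction r with
    | zero =>
      intro _
      refine ⟨1, isClifford_one, hgood, localOn_one _, fun q hq => absurd hq (Nat.not_lt_zero _), ?_⟩
      intro P _ p hp
      exact absurd p.2 (by omega)
    | succ r ih =>
      intro hr
      obtain ⟨A, hA, hgA, hlA, hB, hZ⟩ := ih (by omega)
      set r' : Fin k := ⟨r, by omega⟩ with hr'
      obtain ⟨S, hS, hlS, hgS, Q, hQ, hQ0, hQ3⟩ := hstep r A (hA.act (g r')) (by omega) hgA
      have hactS : hS.act (hA.act (g r')) = Q := hS.act_eq hQ
      have hold : ∀ q : Fin k, (q : ℕ) < r → hS.act (hA.act (g q)) = hA.act (g q) := by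
        intro q hq
        refine (hlS _ _ (hS.maps_act _)).2 fun i hi => ?_
        obtain ⟨p, hp, rfl⟩ := Finset.mem_image.mp hi
        exact hB q hq p (by simpa using hp)
      have hQout : ∀ i, i ∉ Finset.univ.image σ → Q i = 0 := by
        intro i hi
        rw [(hlS _ _ hQ).1 i fun h' => hi (freeSites_subset σ r h'),
          (hlA _ _ (hA.maps_act _)).1 i hi, hg _ _ hi]
      have hQZ : ∀ p : Fin k, k ≤ (p : ℕ) + r → Q (σ p) = 0 ∨ Q (σ p) = 3 := by
        intro p hp
        rw [(hlS _ _ hQ).1 (σ p) fun h' => by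
          rw [apply_mem_freeSites hσ] at h'; omega]
        refine hZ _ (fun q _ => ?_) p hp
        rw [symp_act, hgg]
      -- without the `Z` at the last free site, `g r` would commute with its partner `h r`
      have hlast : ∀ p : Fin k, (p : ℕ) + r + 1 = k → Q (σ p) = 3 := by
        intro p hp
        refine (hQ3 p hp).resolve_left fun hp0 => ?_
        have h1 : symp (hS.act (hA.act (h r'))) Q = 1 := by
          rw [← hactS, symp_act, symp_act, hhg, if_pos rfl]
        have hHZ := hZ (hS.act (hA.act (h r'))) (fun q hq => by
          rw [← hold q hq, symp_act, symp_act, hhg, if_neg]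
          rintro rfl
          simp [hr'] at hq)
        have h0 : symp (hS.act (hA.act (h r'))) Q = 0 := by
          refine Finset.sum_eq_zero fun i _ => ?_
          by_cases hi : i ∈ Finset.univ.image σ
          · obtain ⟨p', -, rfl⟩ := Finset.mem_image.mp hi
            rcases lt_trichotomy ((p' : ℕ) + r + 1) k with h' | h' | h'
            · simp [hQ0 p' h', om]
            · have : p' = p := Fin.ext (by omega)
              simp [this, hp0, om]
            · exact om_eq_zero_of_diagonal (hHZ p' (by omega)) (hQZ p' (by omega))
          · simp [hQout i hi, om]
        rw [h0] at h1
        exact absurd h1 (by decide)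
      refine ⟨S * A, hS.mul hA, hgS, (hlS.mono (freeSites_subset σ r)).mul hlA hS hA, ?_, ?_⟩
      · intro q hq p hp
        rw [act_mul hS hA]
        rcases Nat.lt_succ_iff_lt_or_eq.mp hq with hq | hq
        · rw [hold q hq]
          exact hB q hq p (by omega)
        · have : q = r' := Fin.ext hq
          rw [this, hactS]
          exact hQ0 p (by omega)
      · intro P hP p hp
        have hPZ := hZ P fun q hq => by
          have := hP q (by omega)
          rwa [act_mul hS hA, hold q hq] at this
        by_cases hp' : k ≤ (p : ℕ) + r
        · exact hPZ p hp'
        · have hPr := hP r' (Nat.lt_succ_self r)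
          rw [act_mul hS hA, hactS, symp, Finset.sum_eq_single (σ p)] at hPr
          · rw [hlast p (by omega)] at hPr
            exact om_three_eq_zero hPr
          · intro i _ hip
            by_cases hi : i ∈ Finset.univ.image σ
            · obtain ⟨p', -, rfl⟩ := Finset.mem_image.mp hi
              rcases lt_trichotomy ((p' : ℕ) + r + 1) k with h' | h' | h'
              · simp [hQ0 p' h', om]
              · exact absurd (congrArg σ (Fin.ext (by omega))) hip
              · exact om_eq_zero_of_diagonal (hPZ p' (by omega)) (hQZ p' (by omega))
            · simp [hQout i hi, om]
          · simp
  obtain ⟨A, hA, hgA, hlA, -, hZ⟩ := main k le_rfl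
  refine ⟨A, hgA, hA, hlA, fun q => ⟨hA.act (g q), hA.maps_act _, ?_, ?_⟩⟩
  · intro i
    by_cases hi : i ∈ Finset.univ.image σ
    · obtain ⟨p, -, rfl⟩ := Finset.mem_image.mp hi
      exact hZ _ (fun q' _ => by rw [symp_act, hgg]) p (by omega)
    · left
      rw [(hlA _ _ (hA.maps_act _)).1 i hi, hg _ _ hi]
  · intro i hi
    rw [(hlA _ _ (hA.maps_act _)).1 i hi, hg _ _ hi]

/-- Commuting independent Pauli strings are simultaneously diagonalized by a Clifford unitary. -/
lemma exists_clifford_diagonalizing {k : ℕ} (g h : Fin k → Fin k → Fin 4)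
    (hgg : ∀ q q', symp (g q) (g q') = 0)
    (hhg : ∀ q q', symp (h q) (g q') = if q = q' then 1 else 0) :
    ∃ A : Op (Fin k), IsClifford A ∧ ∀ q, ∃ Q, Maps A (g q) Q ∧ ZType Q := by
  obtain ⟨A, -, hA, -, hQ⟩ := exists_diagonalizing id Function.injective_id g h
    (fun q i hi => absurd (by simp) hi) hgg hhg (fun _ _ => True) trivial (by
      intro r A P hr _
      have ht : (⟨k - r - 1, by omega⟩ : Fin k) ∈ freeSites id r := by
        have := (apply_mem_freeSites (σ := id) Function.injective_id (r := r)
          (p := (⟨k - r - 1, by omega⟩ : Fin k))).mpr (by simp only; omega)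
        exact this
      obtain ⟨B, hB, Q, hQ, -, h0, h3⟩ := exists_clifford_clear (freeSites id r) ⟨_, ht⟩ P
      refine ⟨_, embed_isClifford hB, embed_localOn hB, trivial, Q, hQ, fun p hp => ?_,
        fun p hp => ?_⟩
      · refine h0 p ((apply_mem_freeSites (σ := id) Function.injective_id).mpr (by omega)) ?_
        rintro rfl
        simp only at hp
        omega
      · have : p = ⟨k - r - 1, by omega⟩ := Fin.ext (by simp only; omega)
        rw [this]
        exact h3)
  exact ⟨A, hA, fun q => (hQ q).imp fun Q h => ⟨h.1, h.2.1⟩⟩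

end Elimination

/-! ### Complete families of mutually unbiased stabilizer bases -/

section Unbiased

variable {ι : Type} [Fintype ι] [DecidableEq ι]

lemma IsClifford.maps_conjTranspose {A : Op ι} (hA : IsClifford A) (P : ι → Fin 4) :
    Maps Aᴴ (hA.act P) P := by
  have key : Aᴴ * (A * pauliString P * Aᴴ) * A = pauliString P := hA.conj_cancel _
  rcases (hA.maps_act P).eq_or_neg hA.1 with h | h
  · refine ⟨1, ?_⟩
    rw [Matrix.conjTranspose_conjTranspose, ← h, key, one_smul]
  · refine ⟨-1, ?_⟩
    rw [← neg_eq_iff_eq_neg] at h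
    rw [Matrix.conjTranspose_conjTranspose, ← h, Matrix.mul_neg, Matrix.neg_mul, key, neg_one_smul]

lemma IsClifford.conjTranspose {A : Op ι} (hA : IsClifford A) : IsClifford Aᴴ := by
  refine isClifford_of_maps ?_ fun P => ⟨hA.act.symm P, ?_⟩
  · rw [mem_unitaryGroup_iff_and, Matrix.conjTranspose_conjTranspose]
    exact ⟨hA.conjTranspose_mul, hA.mul_conjTranspose⟩
  · have := hA.maps_conjTranspose (hA.act.symm P)
    rwa [Equiv.apply_symm_apply] at this

lemma conj_single_apply (W : Op ι) (c x y : Bits ι) :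
    (W * (Matrix.single c c 1 : Op ι) * Wᴴ) x y = W x c * star (W y c) := by
  simp [Matrix.mul_apply, Matrix.single_apply, Matrix.conjTranspose_apply, ite_and]

lemma symp_eq_zero_of_zType {P Q : ι → Fin 4} (hP : ZType P) (hQ : ZType Q) : symp P Q = 0 :=
  Finset.sum_eq_zero fun i _ => om_eq_zero_of_diagonal (hP i) (hQ i)

/-- Two stabilizer bases are mutually unbiased if their stabilizer groups intersect trivially. -/
lemma unbiased_of_disjoint {U V : Op ι} (hU : IsClifford U) (hV : IsClifford V)
    (h : ∀ P, ZType (hU.act P) → ZType (hV.act P) → P = 0) (b b' : Bits ι) :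
    ‖(U * Vᴴ) b b'‖ ^ 2 = 1 / 2 ^ Fintype.card ι := by
  have hW : IsClifford (U * Vᴴ) := hU.mul hV.conjTranspose
  have hWZ : ∀ Q, ZType Q → ZType (hW.act Q) → Q = 0 := by
    intro Q hQ hWQ
    obtain ⟨P, rfl⟩ := hV.act.surjective Q
    have : hW.act (hV.act P) = hU.act P :=
      hW.act_eq ((hV.maps_conjTranspose P).comp (hU.maps_act P))
    rw [this] at hWQ
    rw [h P hWQ hQ, hV.act_zero]
  set W := U * Vᴴ
  have h1 : (W * (Matrix.single b' b' 1 : Op ι) * Wᴴ) b b = 1 / 2 ^ Fintype.card ι := by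
    rw [single_expansion]
    simp only [Matrix.mul_sum, Matrix.sum_mul, Matrix.mul_smul, Matrix.smul_mul, Matrix.sum_apply,
      Matrix.smul_apply, smul_eq_mul]
    rw [Finset.sum_eq_single 0]
    · simp [hW.mul_conjTranspose]
    · intro Q _ hQ
      by_cases hZ : ZType Q
      · have hn : ¬ ZType (hW.act Q) := fun h' => hQ (hWZ Q hZ h')
        obtain ⟨c, hc⟩ := hW.maps_act Q
        rw [hc, Matrix.smul_apply, pauliString_diag_eq_zero hn]
        simp
      · rw [pauliString_diag_eq_zero hZ]
        simp
    · simp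
  rw [conj_single_apply, Complex.star_def, Complex.mul_conj, Complex.normSq_eq_norm_sq] at h1
  apply Complex.ofReal_injective
  rw [h1]
  push_cast
  rfl

end Unbiased

/-- The first symplectic coordinate of a Pauli matrix: the exponent of `X`. -/
def xBit : Fin 4 → ZMod 2 := ![0, 1, 1, 0]

/-- The second symplectic coordinate of a Pauli matrix: the exponent of `Z`. -/
def zBit : Fin 4 → ZMod 2 := ![0, 0, 1, 1]

/-- The label of the Pauli matrix with the given exponents of `X` and `Z`. -/
def ofBits (x z : ZMod 2) : Fin 4 := if x = 0 then if z = 0 then 0 else 3 else if z = 0 then 1 else 2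

lemma om_eq_bits (a b : Fin 4) : om a b = xBit a * zBit b + zBit a * xBit b := by
  revert a b; decide

lemma xBit_ofBits (x z : ZMod 2) : xBit (ofBits x z) = x := by revert x z; decide

lemma zBit_ofBits (x z : ZMod 2) : zBit (ofBits x z) = z := by revert x z; decide

lemma eq_zero_of_bits {a : Fin 4} (hx : xBit a = 0) (hz : zBit a = 0) : a = 0 := by
  revert a; decide

/-- The generators `X_q Z^{A e_q}` of the stabilizer group attached to a symmetric matrix `A`. -/
def graphGenerator {k : ℕ} (A : Fin k → Fin k → ZMod 2) (q : Fin k) : Fin k → Fin 4 :=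
  fun p => ofBits (if p = q then 1 else 0) (A p q)

lemma symp_graphGenerator {k : ℕ} (A : Fin k → Fin k → ZMod 2) (P : Fin k → Fin 4) (q : Fin k) :
    symp P (graphGenerator A q) = ∑ p, xBit (P p) * A p q + zBit (P q) := by
  simp [symp, graphGenerator, om_eq_bits, xBit_ofBits, zBit_ofBits, Finset.sum_add_distrib]

lemma exists_graph_clifford {k : ℕ} (A : Fin k → Fin k → ZMod 2) (hA : ∀ p q, A p q = A q p) :
    ∃ U : Op (Fin k), ∃ hU : IsClifford U, ∀ P, ZType (hU.act P) →
      ∀ q, ∑ p, xBit (P p) * A p q + zBit (P q) = 0 := by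
  obtain ⟨U, hU, h⟩ := exists_clifford_diagonalizing (graphGenerator A)
    (fun q => Pi.single q 3) (fun q q' => by
      rw [symp_graphGenerator]
      simp only [graphGenerator, xBit_ofBits, zBit_ofBits, ite_mul, one_mul, zero_mul,
        Finset.sum_ite_eq', Finset.mem_univ, if_true]
      rw [hA]
      exact CharTwo.add_self_eq_zero _)
    (fun q q' => by
      rw [symp_comm, symp_single, om_eq_bits]
      rw [graphGenerator, xBit_ofBits, zBit_ofBits]
      simp [zBit, xBit])
  refine ⟨U, hU, fun P hP q => ?_⟩
  obtain ⟨Q, hQ, hZ⟩ := h q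
  rw [← symp_graphGenerator, ← symp_act hU, hU.act_eq hQ]
  exact symp_eq_zero_of_zType hP hZ

/-- For each `k ≥ 1` there are `2 ^ k + 1` mutually unbiased stabilizer bases: the computational
basis, and for every `a` in the field with `2 ^ k` elements the basis stabilized by the strings
`X^x Z^{A x}`, where `A` is the Gram matrix of the bilinear form `tr (a x y)`. -/
theorem exists_isStabilizerMUB (k : ℕ) (hk : 0 < k) :
    ∃ U : Fin (2 ^ k + 1) → Op (Fin k), IsStabilizerMUB U := by
  let F := GaloisField 2 k
  have hfr : Module.finrank (ZMod 2) F = k := GaloisField.finrank 2 hk.ne'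
  have : Fintype F := Fintype.ofFinite F
  have hcard : Fintype.card F = 2 ^ k := by
    rw [← Nat.card_eq_fintype_card]
    exact GaloisField.card 2 k hk.ne'
  let e : Module.Basis (Fin k) (ZMod 2) F := Module.finBasisOfFinrankEq _ _ hfr
  let A : F → Fin k → Fin k → ZMod 2 := fun a p q => Algebra.trace (ZMod 2) F (a * e p * e q)
  have hA : ∀ a p q, A a p q = A a q p := fun a p q => by
    simp only [A]
    congr 1
    ring
  -- differences of the Gram matrices are invertible, as the trace form is nondegenerate
  have hinv : ∀ a a', a ≠ a' → ∀ x : Fin k → ZMod 2,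
      (∀ q, ∑ p, x p * A a p q = ∑ p, x p * A a' p q) → x = 0 := by
    intro a a' haa x hx
    have h1 : ∀ a q, ∑ p, x p * A a p q =
        Algebra.trace (ZMod 2) F (a * (∑ p, x p • e p) * e q) := by
      intro a q
      rw [Finset.mul_sum, Finset.sum_mul, map_sum]
      refine Finset.sum_congr rfl fun p _ => ?_
      rw [mul_smul_comm, smul_mul_assoc, map_smul, smul_eq_mul]
    have h2 : ∀ q, Algebra.traceForm (ZMod 2) F ((a - a') * ∑ p, x p • e p) (e q) = 0 := by
      intro q
      rw [Algebra.traceForm_apply, sub_mul, sub_mul, map_sub, ← h1, ← h1, hx, sub_self]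
    have h3 : (a - a') * ∑ p, x p • e p = 0 := by
      refine (traceForm_nondegenerate (ZMod 2) F).1 _ fun y => ?_
      have : Algebra.traceForm (ZMod 2) F ((a - a') * ∑ p, x p • e p) = 0 :=
        e.ext fun q => by rw [h2]; rfl
      rw [this]
      rfl
    have h4 := (mul_eq_zero.mp h3).resolve_left (sub_ne_zero.mpr haa)
    funext p
    exact Fintype.linearIndependent_iff.mp e.linearIndependent x h4 p
  choose U hU hUZ using fun a => exists_graph_clifford (A a) (hA a)
  let f : Fin (2 ^ k) ≃ F := (Fintype.equivFinOfCardEq hcard).symm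
  have h0 : ∀ (a : F) P, ZType (isClifford_one.act P) → ZType ((hU a).act P) → P = 0 := by
    intro a P h1 h2
    rw [isClifford_one.act_eq (maps_one P)] at h1
    have hx : ∀ p, xBit (P p) = 0 := fun p => by
      rcases h1 p with h | h <;> simp [h, xBit]
    funext q
    have hz := hUZ a P h2 q
    simp only [hx, zero_mul, Finset.sum_const_zero, zero_add] at hz
    exact eq_zero_of_bits (hx q) hz
  have h1 : ∀ a a', a ≠ a' → ∀ P, ZType ((hU a).act P) → ZType ((hU a').act P) → P = 0 := by
    intro a a' haa P h h'
    have hx := hinv a a' haa (fun p => xBit (P p)) fun q =>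
      add_right_cancel ((hUZ a P h q).trans (hUZ a' P h' q).symm)
    have hx' : ∀ p, xBit (P p) = 0 := congrFun hx
    funext q
    have hz := hUZ a P h q
    simp only [hx', zero_mul, Finset.sum_const_zero, zero_add] at hz
    exact eq_zero_of_bits (hx' q) hz
  refine ⟨Fin.cons 1 fun j => U (f j), ?_, ?_⟩
  · intro j
    refine Fin.cases ?_ (fun j => ?_) j
    · exact isClifford_one
    · exact hU _
  · have hk' : ∀ x : ℝ, x = 1 / 2 ^ Fintype.card (Fin k) → x = 1 / 2 ^ k := by
      intro x hx
      rwa [Fintype.card_fin] at hx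
    intro j j'
    refine Fin.cases ?_ (fun j => ?_) j <;> refine Fin.cases ?_ (fun j' => ?_) j'
    · exact fun h => absurd rfl h
    · intro _ b b'
      exact hk' _ (unbiased_of_disjoint isClifford_one (hU (f j')) (h0 _) b b')
    · intro _ b b'
      exact hk' _ (unbiased_of_disjoint (hU (f j)) isClifford_one (fun P h h' => h0 _ P h' h) b b')
    · intro h b b'
      refine hk' _ (unbiased_of_disjoint (hU (f j)) (hU (f j')) (h1 _ _ fun h' => h ?_) b b')
      rw [f.injective h']

/-! ### Tensor products over the blocks -/

section Blocks

variable {m k : ℕ}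

/-- The part of a Pauli label in the block `i`. -/
def row (P : Fin m × Fin k → Fin 4) (i : Fin m) : Fin k → Fin 4 := fun q => P (i, q)

lemma blockTensor_eq (V : Fin m → Op (Fin k)) :
    blockTensor V = (tensor V).submatrix (Equiv.curry (Fin m) (Fin k) (Fin 2))
      (Equiv.curry (Fin m) (Fin k) (Fin 2)) := rfl

lemma blockTensor_mul (V W : Fin m → Op (Fin k)) :
    blockTensor V * blockTensor W = blockTensor fun i => V i * W i := by
  rw [blockTensor_eq, blockTensor_eq, Matrix.submatrix_mul_equiv, tensor_mul]
  rfl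

lemma blockTensor_conjTranspose (V : Fin m → Op (Fin k)) :
    (blockTensor V)ᴴ = blockTensor fun i => (V i)ᴴ := by
  rw [blockTensor_eq, Matrix.conjTranspose_submatrix, tensor_conjTranspose]
  rfl

lemma blockTensor_one : blockTensor (fun _ : Fin m => (1 : Op (Fin k))) = 1 := by
  rw [blockTensor_eq, tensor_one, Matrix.submatrix_one_equiv]

lemma blockTensor_smul (c : Fin m → ℂ) (V : Fin m → Op (Fin k)) :
    (blockTensor fun i => c i • V i) = (∏ i, c i) • blockTensor V := by
  rw [blockTensor_eq, tensor_smul]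
  rfl

lemma pauliString_eq_blockTensor (P : Fin m × Fin k → Fin 4) :
    pauliString P = blockTensor fun i => pauliString (row P i) := by
  ext s t
  simp only [pauliString, blockTensor, Matrix.of_apply, row, Fintype.prod_prod_type]

lemma blockTensor_maps {V : Fin m → Op (Fin k)} {P Q : Fin m × Fin k → Fin 4}
    (h : ∀ i, Maps (V i) (row P i) (row Q i)) : Maps (blockTensor V) P Q := by
  choose c hc using h
  refine ⟨∏ i, c i, ?_⟩
  rw [pauliString_eq_blockTensor, pauliString_eq_blockTensor Q, blockTensor_conjTranspose,
    blockTensor_mul, blockTensor_mul, ← blockTensor_smul]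
  simp only [hc]

lemma blockTensor_isClifford {V : Fin m → Op (Fin k)} (hV : ∀ i, IsClifford (V i)) :
    IsClifford (blockTensor V) := by
  refine isClifford_of_maps ?_ fun P =>
    ⟨fun x => (hV x.1).act (row P x.1) x.2, blockTensor_maps fun i => (hV i).maps_act _⟩
  rw [mem_unitaryGroup_iff_and, blockTensor_conjTranspose, blockTensor_mul, blockTensor_mul]
  simp only [fun i => (hV i).mul_conjTranspose, fun i => (hV i).conjTranspose_mul]
  exact ⟨blockTensor_one, blockTensor_one⟩

lemma act_blockTensor {V : Fin m → Op (Fin k)} (hV : ∀ i, IsClifford (V i))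
    (P : Fin m × Fin k → Fin 4) (x : Fin m × Fin k) :
    (blockTensor_isClifford hV).act P x = (hV x.1).act (row P x.1) x.2 := by
  have : Maps (blockTensor V) P fun x => (hV x.1).act (row P x.1) x.2 :=
    blockTensor_maps fun i => (hV i).maps_act _
  rw [(blockTensor_isClifford hV).act_eq this]

/-- The label on the whole register that equals `p` in the block `i` and is trivial elsewhere. -/
def lift (i : Fin m) (p : Fin k → Fin 4) : Fin m × Fin k → Fin 4 :=
  fun x => if x.1 = i then p x.2 else 0

lemma symp_lift (i : Fin m) (p p' : Fin k → Fin 4) : symp (lift i p) (lift i p') = symp p p' := by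
  simp only [symp, Fintype.sum_prod_type]
  rw [Finset.sum_eq_single i]
  · simp [lift]
  · intro j _ hj
    simp [lift, hj, om]
  · simp

lemma lift_maps {V : Fin m → Op (Fin k)} (hV : ∀ i, IsClifford (V i)) (i : Fin m)
    {p p' : Fin k → Fin 4} (h : Maps (V i) p p') : Maps (blockTensor V) (lift i p) (lift i p') := by
  refine blockTensor_maps fun j => ?_
  have hrow : ∀ p : Fin k → Fin 4, row (lift i p) j = if j = i then p else 0 := by
    intro p
    funext q
    simp only [row, lift]
    split_ifs <;> rfl
  rw [hrow, hrow]
  split_ifs with hj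
  · rwa [hj]
  · exact ⟨1, by simp [(hV j).mul_conjTranspose]⟩

end Blocks

/-! ### Pipelined sweeps of nearest-neighbour gates -/

section Circuits

variable {m k : ℕ}

lemma LocalGate.toOp_eq (g : LocalGate m k) : g.toOp = embed g.supp g.mat := by
  ext s t
  simp only [LocalGate.toOp, embed, Matrix.of_apply]

lemma LocalGate.isClifford_toOp (g : LocalGate m k) : IsClifford g.toOp := by
  rw [g.toOp_eq]
  exact embed_isClifford g.clifford

lemma LocalGate.localOn (g : LocalGate m k) : LocalOn g.supp g.toOp := by
  rw [g.toOp_eq]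
  exact embed_localOn g.clifford

/-- Gates to be applied at each of the times `0, 1, 2, …`. -/
abbrev Schedule (m k : ℕ) : Type := ℕ → List (LocalGate m k)

/-- The product of the gates in a list. -/
def gateProd (l : List (LocalGate m k)) : Op (Fin m × Fin k) := (l.map LocalGate.toOp).prod

/-- The unitary of the first `N` layers of a schedule. -/
def run (c : Schedule m k) : ℕ → Op (Fin m × Fin k)
  | 0 => 1
  | N + 1 => gateProd (c N) * run c N

lemma run_congr {c c' : Schedule m k} {N : ℕ} (h : ∀ t < N, c t = c' t) : run c N = run c' N := by
  induction N with
  | zero => rfl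
  | succ N ih => rw [run, run, h N (Nat.lt_succ_self N), ih fun t ht => h t (by omega)]

lemma run_of_empty {c : Schedule m k} {N N' : ℕ} (hN : N ≤ N') (h : ∀ t, N ≤ t → c t = []) :
    run c N' = run c N := by
  induction N', hN using Nat.le_induction with
  | base => rfl
  | succ N' hN' ih => rw [run, h N' hN', ih]; simp [gateProd]

lemma gateProd_spec {S : Finset (Fin m × Fin k)} {l : List (LocalGate m k)}
    (h : ∀ g ∈ l, g.supp ⊆ S) : IsClifford (gateProd l) ∧ LocalOn S (gateProd l) := by
  induction l with
  | nil => exact ⟨by simpa [gateProd] using isClifford_one, by simpa [gateProd] using localOn_one S⟩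
  | cons g l ih =>
    obtain ⟨h1, h2⟩ := ih fun g hg => h g (List.mem_cons_of_mem _ hg)
    have h3 := g.localOn.mono (h g List.mem_cons_self)
    have h4 : gateProd (g :: l) = g.toOp * gateProd l := by simp [gateProd]
    rw [h4]
    exact ⟨g.isClifford_toOp.mul h1, h3.mul h2 g.isClifford_toOp h1⟩

lemma run_spec {S : Finset (Fin m × Fin k)} {c : Schedule m k} (h : ∀ t, ∀ g ∈ c t, g.supp ⊆ S)
    (N : ℕ) : IsClifford (run c N) ∧ LocalOn S (run c N) := by
  induction N with
  | zero => exact ⟨isClifford_one, localOn_one S⟩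
  | succ N ih =>
    obtain ⟨h1, h2⟩ := gateProd_spec (h N)
    exact ⟨h1.mul ih.1, h2.mul ih.2 h1 ih.1⟩

lemma gateProd_commute {l : List (LocalGate m k)} {X : Op (Fin m × Fin k)}
    (h : ∀ g ∈ l, Commute g.toOp X) : Commute (gateProd l) X := by
  refine Commute.list_prod_left _ _ fun A hA => ?_
  obtain ⟨g, hg, rfl⟩ := List.mem_map.mp hA
  exact h g hg

/-- Gates of `c'` can be pulled ahead of the later gates of `c` if their supports are disjoint. -/
lemma run_merge {c c' : Schedule m k}
    (h : ∀ t s, t < s → ∀ g' ∈ c' t, ∀ g ∈ c s, Disjoint g'.supp g.supp) (N : ℕ) :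
    run (fun t => c' t ++ c t) N = run c' N * run c N := by
  have hcomm : ∀ N s, N ≤ s → Commute (gateProd (c s)) (run c' N) := by
    intro N
    induction N with
    | zero => exact fun s _ => Commute.one_right _
    | succ N ih =>
      intro s hs
      refine Commute.mul_right ?_ (ih s (by omega))
      refine gateProd_commute fun g hg => (gateProd_commute fun g' hg' => ?_).symm
      rw [g.toOp_eq, g'.toOp_eq]
      exact embed_comm (h N s hs g' hg' g hg) _ _
  induction N with
  | zero => simp [run]
  | succ N ih =>
    have happ : gateProd (c' N ++ c N) = gateProd (c' N) * gateProd (c N) := by simp [gateProd]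
    rw [run, run, run, happ, ih, Matrix.mul_assoc, ← Matrix.mul_assoc (gateProd (c N)),
      (hcomm N N le_rfl).eq]
    simp only [Matrix.mul_assoc]

/-- One sweep through the first `l` sites of the block `i`, starting at time `2 * r`: the gate at
time `2 * r + j` acts on the sites `j - 1` and `j` and pushes the string `P` off the site
`j - 1`. -/
lemma exists_sweep (i : Fin m) (r l : ℕ) (hl : l ≤ k) (P : Fin m × Fin k → Fin 4) :
    ∃ c : Schedule m k, (∀ t, (c t).length ≤ 1) ∧
      (∀ t, ∀ g ∈ c t, ∀ x ∈ g.supp, x.1 = i ∧ (x.2 : ℕ) + 2 * r ≤ t ∧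
        t ≤ (x.2 : ℕ) + 2 * r + 1 ∧ (x.2 : ℕ) < l) ∧
      (∀ t, 2 * r + l ≤ t → c t = []) ∧
      ∃ Q, Maps (run c (2 * r + l)) P Q ∧ (∀ p : Fin k, (p : ℕ) + 1 < l → Q (i, p) = 0) ∧
        ∀ p : Fin k, (p : ℕ) + 1 = l → Q (i, p) = 0 ∨ Q (i, p) = 3 := by
  induction l with
  | zero =>
    refine ⟨fun _ => [], by simp, by simp, by simp, P, ?_, by simp, by simp⟩
    rw [run_of_empty (N := 0) (Nat.zero_le _) (by simp)]
    exact maps_one P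
  | succ l ih =>
    obtain ⟨c, hlen, hsupp, hempty, Q, hQ, hQ0, hQ3⟩ := ih (by omega)
    let S : Finset (Fin m × Fin k) :=
      Finset.univ.filter fun x => x.1 = i ∧ (x.2 : ℕ) ≤ l ∧ l ≤ (x.2 : ℕ) + 1
    have hS : ∀ x, x ∈ S ↔ x.1 = i ∧ (x.2 : ℕ) ≤ l ∧ l ≤ (x.2 : ℕ) + 1 := by simp [S]
    let t₀ : S := ⟨(i, ⟨l, by omega⟩), by simp [hS]⟩
    obtain ⟨B, hB, R, hR, hRout, hR0, hR3⟩ := exists_clifford_clear S t₀ Q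
    let g : LocalGate m k :=
      { supp := S
        near := fun p hp q hq => by
          rw [hS] at hp hq
          exact ⟨hp.1.trans hq.1.symm, by omega⟩
        mat := B
        clifford := hB }
    have hold : ∀ t, t ≠ 2 * r + l → Function.update c (2 * r + l) [g] t = c t :=
      fun t ht => Function.update_of_ne ht _ _
    have hnew : Function.update c (2 * r + l) [g] (2 * r + l) = [g] := Function.update_self _ _ _
    refine ⟨Function.update c (2 * r + l) [g], ?_, ?_, ?_, R, ?_, ?_, ?_⟩
    · intro t
      by_cases ht : t = 2 * r + l
      · subst ht; rw [hnew]; simp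
      · rw [hold t ht]; exact hlen t
    · intro t g' hg' x hx
      by_cases ht : t = 2 * r + l
      · subst ht
        rw [hnew, List.mem_singleton] at hg'
        subst hg'
        obtain ⟨h1, h2, h3⟩ := (hS x).mp hx
        exact ⟨h1, by omega, by omega, by omega⟩
      · rw [hold t ht] at hg'
        obtain ⟨h1, h2, h3, h4⟩ := hsupp t g' hg' x hx
        exact ⟨h1, h2, h3, by omega⟩
    · intro t ht
      rw [hold t (by omega)]
      exact hempty t (by omega)
    · have h1 : run (Function.update c (2 * r + l) [g]) (2 * r + (l + 1)) =
          embed S B * run c (2 * r + l) := by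
        rw [← Nat.add_assoc, run, hnew, run_congr fun t ht => hold t (by omega)]
        congr 1
        simp only [gateProd, List.map_cons, List.map_nil, List.prod_singleton]
        exact g.toOp_eq
      rw [h1]
      exact hQ.comp hR
    · intro p hp
      by_cases hp' : (i, p) ∈ S
      · refine hR0 _ hp' fun h => ?_
        have : (p : ℕ) = l := congrArg (fun x : Fin m × Fin k => (x.2 : ℕ)) h
        omega
      · rw [hRout _ hp']
        rw [hS] at hp'
        have : (p : ℕ) + 1 < l := by
          by_contra h
          exact hp' ⟨rfl, by simp only; omega, by simp only; omega⟩
        exact hQ0 p this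
    · intro p hp
      have : (i, p) = (t₀ : Fin m × Fin k) := by
        refine Prod.ext rfl (Fin.ext ?_)
        simp only [t₀]
        omega
      rw [this]
      exact hR3

/-- The circuit that diagonalizes commuting independent Pauli strings in the block `i` within
`2 * k` layers. Sweep `r` starts at time `2 * r`, when the earlier sweeps are already at least two
sites further. -/
lemma exists_block_schedule (i : Fin m) (g h : Fin k → Fin m × Fin k → Fin 4)
    (hg : ∀ q x, x.1 ≠ i → g q x = 0) (hgg : ∀ q q', symp (g q) (g q') = 0)
    (hhg : ∀ q q', symp (h q) (g q') = if q = q' then 1 else 0) :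
    ∃ c : Schedule m k, (∀ t, (c t).Pairwise fun a b => Disjoint a.supp b.supp) ∧
      (∀ t, ∀ a ∈ c t, ∀ x ∈ a.supp, x.1 = i) ∧
      ∀ q, ∃ Q, Maps (run c (2 * k)) (g q) Q ∧ ZType Q ∧ ∀ x, x.1 ≠ i → Q x = 0 := by
  have hσ : Function.Injective fun p : Fin k => (i, p) := fun p q h => congrArg Prod.snd h
  have hmem : ∀ x : Fin m × Fin k, x ∈ Finset.univ.image (fun p : Fin k => (i, p)) ↔ x.1 = i := by
    intro x
    simp only [Finset.mem_image, Finset.mem_univ, true_and]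
    constructor
    · rintro ⟨p, rfl⟩; rfl
    · rintro rfl; exact ⟨x.2, rfl⟩
  obtain ⟨A, ⟨c, hpw, hsupp, hrun⟩, -, -, hA⟩ := exists_diagonalizing (fun p : Fin k => (i, p)) hσ
    g h (fun q x hx => hg q x fun h' => hx ((hmem x).mpr h')) hgg hhg
    (fun r A => ∃ c : Schedule m k, (∀ t, (c t).Pairwise fun a b => Disjoint a.supp b.supp) ∧
      (∀ t, ∀ a ∈ c t, ∀ x ∈ a.supp, x.1 = i ∧ t + 1 ≤ (x.2 : ℕ) + 2 * r) ∧ run c (2 * k) = A)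
    ⟨fun _ => [], by simp, by simp, run_of_empty (N := 0) (Nat.zero_le _) (by simp)⟩ (by
      rintro r A P hr ⟨c, hpw, hsupp, rfl⟩
      obtain ⟨c', hlen, hsupp', hempty, Q, hQ, hQ0, hQ3⟩ := exists_sweep i r (k - r) (by omega) P
      have hfree : ∀ t, ∀ a ∈ c' t, a.supp ⊆ freeSites (fun p : Fin k => (i, p)) r := by
        intro t a ha x hx
        obtain ⟨h1, h2, h3, h4⟩ := hsupp' t a ha x hx
        have : x = (i, x.2) := Prod.ext h1 rfl
        rw [this]
        exact (apply_mem_freeSites hσ).mpr (by omega)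
      have hdisj : ∀ t s, t ≤ s → ∀ a' ∈ c' t, ∀ a ∈ c s, Disjoint a'.supp a.supp := by
        intro t s hts a' ha' a ha
        refine Finset.disjoint_left.mpr fun x hx' hx => ?_
        have h1 := hsupp' t a' ha' x hx'
        have h2 := hsupp s a ha x hx
        omega
      rw [← run_of_empty (N' := 2 * k) (by omega) hempty] at hQ
      obtain ⟨h1, h2⟩ := run_spec hfree (2 * k)
      refine ⟨run c' (2 * k), h1, h2, ⟨fun t => c' t ++ c t, ?_, ?_, ?_⟩, Q, hQ, ?_, ?_⟩
      · intro t
        refine List.pairwise_append.mpr ⟨?_, hpw t, hdisj t t le_rfl⟩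
        have := hlen t
        match c' t, this with
        | [], _ => exact List.Pairwise.nil
        | [a], _ => exact List.pairwise_singleton _ a
      · intro t a ha x hx
        rcases List.mem_append.mp ha with ha | ha
        · have := hsupp' t a ha x hx
          exact ⟨this.1, by omega⟩
        · have := hsupp t a ha x hx
          exact ⟨this.1, by omega⟩
      · exact run_merge (fun t s hts => hdisj t s hts.le) _
      · exact fun p hp => hQ0 p (by omega)
      · exact fun p hp => hQ3 p (by omega))
  refine ⟨c, hpw, fun t a ha x hx => (hsupp t a ha x hx).1, fun q => ?_⟩
  obtain ⟨Q, h1, h2, h3⟩ := hA q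
  rw [hrun]
  exact ⟨Q, h1, h2, fun x hx => h3 x fun h' => hx ((hmem x).mp h')⟩

/-- Circuits in different blocks run in parallel. -/
lemma exists_schedule (g h : Fin m → Fin k → Fin m × Fin k → Fin 4)
    (hg : ∀ i q x, x.1 ≠ i → g i q x = 0) (hgg : ∀ i q q', symp (g i q) (g i q') = 0)
    (hhg : ∀ i q q', symp (h i q) (g i q') = if q = q' then 1 else 0) :
    ∃ c : Schedule m k, (∀ t, (c t).Pairwise fun a b => Disjoint a.supp b.supp) ∧
      ∀ i q, ∃ Q, Maps (run c (2 * k)) (g i q) Q ∧ ZType Q := by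
  have main : ∀ a ≤ m, ∃ c : Schedule m k,
      (∀ t, (c t).Pairwise fun a b => Disjoint a.supp b.supp) ∧
      (∀ t, ∀ b ∈ c t, ∀ x ∈ b.supp, (x.1 : ℕ) < a) ∧
      ∀ i : Fin m, (i : ℕ) < a → ∀ q, ∃ Q, Maps (run c (2 * k)) (g i q) Q ∧ ZType Q ∧
        ∀ x, x.1 ≠ i → Q x = 0 := by
    intro a
    induction a with
    | zero => exact fun _ => ⟨fun _ => [], by simp, by simp, by simp⟩
    | succ a ih =>
      intro ha
      obtain ⟨c, hpw, hsupp, hQ⟩ := ih (by omega)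
      set i₀ : Fin m := ⟨a, by omega⟩ with hi₀
      obtain ⟨c', hpw', hsupp', hQ'⟩ := exists_block_schedule i₀ (g i₀) (h i₀) (hg i₀) (hgg i₀)
        (hhg i₀)
      have hdisj : ∀ t s, ∀ b' ∈ c' t, ∀ b ∈ c s, Disjoint b'.supp b.supp := by
        intro t s b' hb' b hb
        refine Finset.disjoint_left.mpr fun x hx' hx => ?_
        have h1 := hsupp' t b' hb' x hx'
        have h2 := hsupp s b hb x hx
        rw [h1, hi₀] at h2
        simp at h2
      refine ⟨fun t => c' t ++ c t, fun t => List.pairwise_append.mpr ⟨hpw' t, hpw t, hdisj t t⟩,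
        ?_, ?_⟩
      · intro t b hb x hx
        rcases List.mem_append.mp hb with hb | hb
        · rw [hsupp' t b hb x hx]
          exact Nat.lt_succ_self a
        · exact Nat.lt_succ_of_lt (hsupp t b hb x hx)
      · intro i hi q
        rw [run_merge fun t s _ => hdisj t s]
        rcases Nat.lt_succ_iff_lt_or_eq.mp hi with hi | hi
        · obtain ⟨Q, h1, h2, h3⟩ := hQ i hi q
          obtain ⟨hc, hl⟩ := run_spec (S := Finset.univ.filter fun x => x.1 = i₀) (c := c')
            (fun t b hb x hx => by simpa using hsupp' t b hb x hx) (2 * k)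
          obtain ⟨R, hR⟩ := hc.exists_maps Q
          have hRQ := (hl Q R hR).2 fun x hx => h3 x fun hxi => by
            have : x.1 = i₀ := by simpa using hx
            rw [← hxi, this, hi₀] at hi
            simp at hi
          exact ⟨Q, h1.comp (hRQ ▸ hR), h2, h3⟩
        · have hi' : i = i₀ := Fin.ext hi
          rw [hi']
          obtain ⟨Q, h1, h2, h3⟩ := hQ' q
          obtain ⟨hc, hl⟩ := run_spec (S := Finset.univ.filter fun x => (x.1 : ℕ) < a) (c := c)
            (fun t b hb x hx => by simpa using hsupp t b hb x hx) (2 * k)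
          obtain ⟨R, hR⟩ := hc.exists_maps (g i₀ q)
          have hRQ := (hl _ R hR).2 fun x hx => hg i₀ q x fun hxi => by
            have : (x.1 : ℕ) < a := by simpa using hx
            rw [hxi, hi₀] at this
            exact lt_irrefl _ this
          exact ⟨Q, (hRQ ▸ hR).comp h1, h2, h3⟩
  obtain ⟨c, hpw, -, hQ⟩ := main m le_rfl
  exact ⟨c, hpw, fun i q => (hQ i i.2 q).imp fun Q h => ⟨h.1, h.2.1⟩⟩

/-- If `C` and `V` diagonalize the same independent Pauli strings, they measure the same basis:
`V * Cᴴ` is a monomial matrix. -/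
lemma sameBasis_of_maps {ι : Type} [Fintype ι] [DecidableEq ι] {C V : Op ι} (hC : IsClifford C)
    (hV : IsClifford V) (h : ∀ s, ∃ P Q, Maps V P (Pi.single s 3) ∧ Maps C P Q ∧ ZType Q) :
    SameBasis C V := by
  set W := V * Cᴴ with hWdef
  have hW : IsClifford W := hV.mul hC.conjTranspose
  have hW' : Wᴴ = C * Vᴴ := by rw [hWdef, Matrix.conjTranspose_mul, Matrix.conjTranspose_conjTranspose]
  have hcol : ∀ a a' b, W a b ≠ 0 → W a' b ≠ 0 → a = a' := by
    intro a a' b ha ha'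
    funext s
    obtain ⟨P, Q, hVP, hCP, hQ⟩ := h s
    have hWQ : Maps W Q (Pi.single s 3) := by
      have := hC.maps_conjTranspose P
      rw [hC.act_eq hCP] at this
      exact this.comp hVP
    obtain ⟨c, hc0, hc⟩ : ∃ c : ℂ, c ≠ 0 ∧ W * pauliString Q * Wᴴ =
        c • pauliString (Pi.single s 3) := by
      rcases hWQ.eq_or_neg hW.1 with h | h
      · exact ⟨1, one_ne_zero, by rw [h, one_smul]⟩
      · exact ⟨-1, by norm_num, by rw [h, neg_one_smul]⟩
    have h1 : W * pauliString Q = c • (pauliString (Pi.single s 3) * W) := by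
      rw [← Matrix.smul_mul, ← hc, Matrix.mul_assoc _ Wᴴ, hW.conjTranspose_mul, Matrix.mul_one]
    have h2 : ∀ x, W x b * pauliString Q b b =
        c * (pauliString (Pi.single s 3) x x * W x b) := by
      intro x
      have := congrFun (congrFun h1 x) b
      rw [Matrix.smul_apply, Matrix.mul_apply, Matrix.mul_apply, Finset.sum_eq_single b,
        Finset.sum_eq_single x] at this
      · exact this
      · intro y _ hy
        rw [pauliString_offDiag (zType_single s) (Ne.symm hy), zero_mul]
      · simp
      · intro y _ hy
        rw [pauliString_offDiag hQ hy, mul_zero]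
      · simp
    have h3 : ∀ x, W x b ≠ 0 → pauliString Q b b = c * pauliString (Pi.single s 3) x x := by
      intro x hx
      refine mul_left_cancel₀ hx ?_
      rw [h2]
      ring
    have h4 := mul_left_cancel₀ hc0 ((h3 a ha).symm.trans (h3 a' ha'))
    rw [pauliString_single_diag, pauliString_single_diag] at h4
    have h5 : (1 : ℂ) ≠ -1 := by norm_num
    generalize a s = x at h4
    generalize a' s = y at h4
    fin_cases x <;> fin_cases y <;> simp_all
  have hex : ∀ b, ∃ a, W a b ≠ 0 := by
    intro b
    by_contra hne
    push Not at hne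
    have := congrFun (congrFun hW.conjTranspose_mul b) b
    simp [Matrix.mul_apply, hne] at this
  choose π hπ using hex
  have hzero : ∀ x b, x ≠ π b → W x b = 0 := by
    intro x b hx
    by_contra h0
    exact hx (hcol _ _ b h0 (hπ b))
  have hE : ∀ b, W * (Matrix.single b b 1 : Op ι) * Wᴴ = Matrix.single (π b) (π b) 1 := by
    intro b
    have hnorm : W (π b) b * star (W (π b) b) = 1 := by
      have := congrFun (congrFun hW.conjTranspose_mul b) b
      rw [Matrix.mul_apply, Finset.sum_eq_single (π b), Matrix.one_apply_eq,
        Matrix.conjTranspose_apply, mul_comm] at this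
      · exact this
      · intro x _ hx
        rw [hzero x b hx, mul_zero]
      · simp
    ext x y
    rw [conj_single_apply, Matrix.single_apply]
    by_cases hx : π b = x
    · by_cases hy : π b = y
      · rw [if_pos ⟨hx, hy⟩, ← hx, ← hy, hnorm]
      · rw [if_neg fun h => hy h.2, hzero y b (Ne.symm hy), star_zero, mul_zero]
    · rw [if_neg fun h => hx h.1, hzero x b (Ne.symm hx), zero_mul]
  have hinj : Function.Injective π := by
    intro b b' hbb
    have h1 := hE b
    rw [hbb, ← hE b'] at h1
    have h2 := congrArg (fun X => Wᴴ * X * W) h1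
    simp only [hW.conj_cancel] at h2
    have h3 := congrFun (congrFun h2 b) b
    by_contra hne
    simp [Ne.symm hne] at h3
  refine ⟨Equiv.ofBijective π (Finite.injective_iff_bijective.mp hinj), fun b => ?_⟩
  rw [Equiv.ofBijective_apply, ← hE b, hW', hWdef]
  have : Vᴴ * (V * Cᴴ * (Matrix.single b b 1 : Op ι) * (C * Vᴴ)) * V =
      (Vᴴ * V) * (Cᴴ * Matrix.single b b 1 * C) * (Vᴴ * V) := by simp only [Matrix.mul_assoc]
  rw [this, hV.conjTranspose_mul, Matrix.one_mul, Matrix.mul_one]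

/-- Every product of stabilizer bases is measured by a nearest-neighbour Clifford circuit of
depth `2 * k`. -/
theorem exists_circuit {V : Fin m → Op (Fin k)} (hV : ∀ i, IsClifford (V i)) :
    ∃ c : Circuit m k, SameBasis c.toOp (blockTensor V) ∧ c.length = 2 * k := by
  let g : Fin m → Fin k → Fin m × Fin k → Fin 4 :=
    fun i q => lift i ((hV i).act.symm (Pi.single q 3))
  let h : Fin m → Fin k → Fin m × Fin k → Fin 4 :=
    fun i q => lift i ((hV i).act.symm (Pi.single q 1))
  have hsymm : ∀ i P Q, symp ((hV i).act.symm P) ((hV i).act.symm Q) = symp P Q := by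
    intro i P Q
    rw [← symp_act (hV i), Equiv.apply_symm_apply, Equiv.apply_symm_apply]
  obtain ⟨c, hpw, hQ⟩ := exists_schedule g h (fun i q x hx => if_neg hx)
    (fun i q q' => by
      simp only [g]
      rw [symp_lift, hsymm]
      exact symp_eq_zero_of_zType (zType_single q) (zType_single q'))
    (fun i q q' => by
      simp only [g, h]
      rw [symp_lift, hsymm, symp_single]
      by_cases hq : q = q'
      · subst hq
        simp [om]
      · simp [om, hq])
  let layer : ℕ → Layer m k := fun t => ⟨c t, hpw t⟩
  have hop : ∀ N, Circuit.toOp ((List.range N).map layer) = run c N := by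
    intro N
    induction N with
    | zero => rfl
    | succ N ih =>
      rw [run, ← ih]
      simp only [Circuit.toOp, List.range_succ, List.map_append, List.map_cons, List.map_nil,
        List.reverse_append, List.reverse_cons, List.reverse_nil, List.nil_append,
        List.singleton_append, List.prod_cons]
      rfl
  refine ⟨(List.range (2 * k)).map layer, ?_, by simp⟩
  rw [hop]
  refine sameBasis_of_maps (run_spec (S := Finset.univ) (fun _ _ _ => Finset.subset_univ _) _).1
    (blockTensor_isClifford hV) fun s => ?_
  obtain ⟨Q, h1, h2⟩ := hQ s.1 s.2
  refine ⟨g s.1 s.2, Q, ?_, h1, h2⟩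
  have h3 := (hV s.1).maps_act ((hV s.1).act.symm (Pi.single s.2 3))
  rw [Equiv.apply_symm_apply] at h3
  have h4 := lift_maps hV s.1 h3
  have h5 : lift s.1 (Pi.single s.2 3) = (Pi.single s 3 : Fin m × Fin k → Fin 4) := by
    funext x
    simp only [lift, Pi.single_apply, Prod.ext_iff]
    split_ifs <;> simp_all
  rwa [h5] at h4

end Circuits

/-! ### Concentration for functions of independent outcomes -/

section Concentration

open ProbabilityTheory

variable {α β : Type} [Fintype α] [DecidableEq α] [Fintype β] [MeasurableSpace β]
  [MeasurableSingletonClass β]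

/-- The average of `f` over the coordinate `a`. -/
def coordAverage (μ : α → Measure β) (a : α) (f : (α → β) → ℝ) (x : α → β) : ℝ :=
  ∫ b, f (Function.update x a b) ∂μ a

/-- Resampling a coordinate does not change the law: exchanging the coordinate `a` of `x` with
an independent copy `b` preserves the joint law of `x` and `b`. -/
lemma integral_coordAverage (μ : α → Measure β) [∀ a, IsProbabilityMeasure (μ a)] (a : α)
    (f : (α → β) → ℝ) :
    ∫ x, coordAverage μ a f x ∂Measure.pi μ = ∫ x, f x ∂Measure.pi μ := by
  let w : (α → β) → ℝ := fun x => ∏ c, (μ c).real {x c}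
  have hw : ∀ x, (Measure.pi μ).real {x} = w x := by
    intro x
    simp only [w, measureReal_def, Measure.pi_singleton, ENNReal.toReal_prod]
  have hswap : ∀ x b, w x * (μ a).real {b} = w (Function.update x a b) * (μ a).real {x a} := by
    intro x b
    simp only [w]
    rw [← Finset.mul_prod_erase _ _ (Finset.mem_univ a),
      ← Finset.mul_prod_erase _ (fun c => (μ c).real {Function.update x a b c}) (Finset.mem_univ a)]
    have : ∀ c ∈ Finset.univ.erase a, (μ c).real {Function.update x a b c} = (μ c).real {x c} := by
      intro c hc
      rw [Function.update_of_ne (Finset.ne_of_mem_erase hc)]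
    rw [Finset.prod_congr rfl this, Function.update_self]
    ring
  have hinv : Function.Involutive fun y : (α → β) × β => (Function.update y.1 a y.2, y.1 a) := by
    intro y
    simp
  have hone : ∑ b, (μ a).real {b} = 1 := by simp
  rw [integral_fintype Integrable.of_finite, integral_fintype Integrable.of_finite]
  simp only [coordAverage, hw, smul_eq_mul]
  have h1 : ∀ x, w x * ∫ b, f (Function.update x a b) ∂μ a =
      ∑ b, w x * (μ a).real {b} * f (Function.update x a b) := by
    intro x
    rw [integral_fintype Integrable.of_finite, Finset.mul_sum]
    refine Finset.sum_congr rfl fun b _ => ?_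
    rw [smul_eq_mul, mul_assoc]
  simp only [h1]
  rw [← Fintype.sum_prod_type' (f := fun x b => w x * (μ a).real {b} * f (Function.update x a b))]
  calc ∑ y : (α → β) × β, w y.1 * (μ a).real {y.2} * f (Function.update y.1 a y.2)
      = ∑ y : (α → β) × β, w (Function.update y.1 a y.2) * (μ a).real {y.1 a} *
          f (Function.update y.1 a y.2) :=
        Finset.sum_congr rfl fun y _ => by rw [hswap]
    _ = ∑ y : (α → β) × β, w y.1 * (μ a).real {y.2} * f y.1 :=
        Equiv.sum_comp (hinv.toPerm _) fun y : (α → β) × β => w y.1 * (μ a).real {y.2} * f y.1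
    _ = ∑ x, w x * f x := by
        rw [Fintype.sum_prod_type]
        refine Finset.sum_congr rfl fun x _ => ?_
        simp only
        rw [← Finset.sum_mul, ← Finset.mul_sum, hone, mul_one]

/-- Hoeffding's lemma for a function of bounded oscillation. -/
lemma integral_exp_le_of_oscillation (μ : Measure β) [IsProbabilityMeasure μ] (X : β → ℝ) (c : ℝ)
    (h : ∀ b b', |X b - X b'| ≤ c) (l : ℝ) :
    ∫ b, Real.exp (l * (X b - ∫ b', X b' ∂μ)) ∂μ ≤ Real.exp ((c / 2) ^ 2 * l ^ 2 / 2) := by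
  have : Nonempty β := nonempty_of_isProbabilityMeasure μ
  obtain ⟨b₀, hb₀⟩ := Finite.exists_min X
  have h1 := (hasSubgaussianMGF_of_mem_Icc (μ := μ) (X := X) (a := X b₀) (b := X b₀ + c)
    (Measurable.of_discrete.aemeasurable)
    (Filter.Eventually.of_forall fun b => ⟨hb₀ b, by linarith [(abs_le.mp (h b b₀)).2]⟩)).mgf_le l
  simpa [mgf, div_pow, sq_abs] using h1

/-- The moment generating function bound in McDiarmid's inequality, by averaging out one coordinate
after the other. -/
lemma mcdiarmid_mgf (μ : α → Measure β) [∀ a, IsProbabilityMeasure (μ a)] (c : α → ℝ)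
    (f : (α → β) → ℝ) (hf : ∀ x a b, |f x - f (Function.update x a b)| ≤ c a) (l : ℝ) :
    ∫ x, Real.exp (l * (f x - ∫ y, f y ∂Measure.pi μ)) ∂Measure.pi μ ≤
      Real.exp ((∑ a, (c a / 2) ^ 2) * l ^ 2 / 2) := by
  have key : ∀ (S : Finset α) (f : (α → β) → ℝ),
      (∀ x a b, |f x - f (Function.update x a b)| ≤ c a) →
      (∀ a, a ∉ S → ∀ x b, f (Function.update x a b) = f x) →
      ∫ x, Real.exp (l * (f x - ∫ y, f y ∂Measure.pi μ)) ∂Measure.pi μ ≤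
        Real.exp ((∑ a ∈ S, (c a / 2) ^ 2) * l ^ 2 / 2) := by
    intro S
    induction S using Finset.induction_on with
    | empty =>
      intro f _ hconst
      have hc : ∀ x y, f x = f y := by
        have h : ∀ (T : Finset α) (x y : α → β), (∀ a, a ∉ T → x a = y a) → f x = f y := by
          intro T
          induction T using Finset.induction_on with
          | empty => exact fun x y h => congrArg f (funext fun a => h a (Finset.notMem_empty a))
          | insert a T _ ih =>
            intro x y h
            rw [← hconst a (Finset.notMem_empty a) x (y a)]
            refine ih _ _ fun b hb => ?_
            by_cases hba : b = a
            · subst hba; simp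
            · rw [Function.update_of_ne hba]
              exact h b (by simp [hba, hb])
        exact fun x y => h Finset.univ x y (by simp)
      have h0 : ∀ x, f x - ∫ y, f y ∂Measure.pi μ = 0 := by
        intro x
        rw [integral_congr_ae (Filter.Eventually.of_forall fun y => hc y x)]
        simp
      simp [h0]
    | insert a S ha ih =>
      intro f hf hconst
      set g := coordAverage μ a f with hg
      have hgf : ∫ y, g y ∂Measure.pi μ = ∫ y, f y ∂Measure.pi μ := integral_coordAverage μ a f
      have hgd : ∀ x a' b', |g x - g (Function.update x a' b')| ≤ c a' := by
        intro x a' b'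
        by_cases h : a' = a
        · subst h
          have : g (Function.update x a' b') = g x := by
            simp [hg, coordAverage]
          rw [this, sub_self, abs_zero]
          exact (abs_nonneg _).trans (hf x a' b')
        · simp only [hg, coordAverage]
          rw [← integral_sub Integrable.of_finite Integrable.of_finite, ← Real.norm_eq_abs]
          have hb : ∀ b, ‖f (Function.update x a b) -
              f (Function.update (Function.update x a' b') a b)‖ ≤ c a' := by
            intro b
            rw [Real.norm_eq_abs, Function.update_comm h]
            exact hf _ a' b'
          have := norm_integral_le_of_norm_le_const (μ := μ a) (Filter.Eventually.of_forall hb)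
          simpa using this
      have hgc : ∀ a', a' ∉ S → ∀ x b, g (Function.update x a' b) = g x := by
        intro a' ha' x b'
        by_cases h : a' = a
        · subst h
          simp [hg, coordAverage]
        · simp only [hg, coordAverage]
          congr 1
          funext b
          rw [Function.update_comm h, hconst a' (by simp [h, ha'])]
      have h1 := ih g hgd hgc
      rw [hgf] at h1
      set e := ∫ y, f y ∂Measure.pi μ
      rw [← integral_coordAverage μ a fun x => Real.exp (l * (f x - e)), Finset.sum_insert ha]
      have h2 : ∀ x, coordAverage μ a (fun x => Real.exp (l * (f x - e))) x ≤
          Real.exp ((c a / 2) ^ 2 * l ^ 2 / 2) * Real.exp (l * (g x - e)) := by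
        intro x
        have h3 := integral_exp_le_of_oscillation (μ a) (fun b => f (Function.update x a b)) (c a)
          (fun b b' => by
            have := hf (Function.update x a b) a b'
            rwa [Function.update_idem] at this) l
        have h4 : ∀ b, Real.exp (l * (f (Function.update x a b) - e)) =
            Real.exp (l * (f (Function.update x a b) - g x)) * Real.exp (l * (g x - e)) := by
          intro b
          rw [← Real.exp_add]
          congr 1
          ring
        simp only [coordAverage, h4]
        rw [integral_mul_const]
        exact mul_le_mul_of_nonneg_right h3 (Real.exp_nonneg _)
      calc ∫ x, coordAverage μ a (fun x => Real.exp (l * (f x - e))) x ∂Measure.pi μ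
          ≤ ∫ x, Real.exp ((c a / 2) ^ 2 * l ^ 2 / 2) * Real.exp (l * (g x - e)) ∂Measure.pi μ :=
            integral_mono Integrable.of_finite Integrable.of_finite h2
        _ ≤ Real.exp ((c a / 2) ^ 2 * l ^ 2 / 2) *
            Real.exp ((∑ a ∈ S, (c a / 2) ^ 2) * l ^ 2 / 2) := by
            rw [integral_const_mul]
            exact mul_le_mul_of_nonneg_left h1 (Real.exp_nonneg _)
        _ = _ := by
            rw [← Real.exp_add]
            congr 1
            ring
  exact key Finset.univ f hf fun a h => absurd (Finset.mem_univ a) h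

/-- McDiarmid's inequality. -/
theorem mcdiarmid (μ : α → Measure β) [∀ a, IsProbabilityMeasure (μ a)] (c : α → ℝ)
    (f : (α → β) → ℝ) (hf : ∀ x a b, |f x - f (Function.update x a b)| ≤ c a) (t : ℝ)
    (ht : 0 ≤ t) :
    (Measure.pi μ).real {x | t ≤ f x - ∫ y, f y ∂Measure.pi μ} ≤
      Real.exp (-t ^ 2 / (2 * ∑ a, (c a / 2) ^ 2)) := by
  have h0 : 0 ≤ ∑ a, (c a / 2) ^ 2 := Finset.sum_nonneg fun a _ => sq_nonneg _
  have h : HasSubgaussianMGF (fun x => f x - ∫ y, f y ∂Measure.pi μ) ⟨_, h0⟩ (Measure.pi μ) :=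
    ⟨fun l => Integrable.of_finite, fun l => mcdiarmid_mgf μ c f hf l⟩
  exact h.measure_ge_le ht

/-- For independent random vectors the variances of the coordinates of the sum add up. -/
lemma integral_norm_sum_sub_le {κ : Type} [Fintype κ] (μ : α → Measure β)
    [∀ a, IsProbabilityMeasure (μ a)] (v : α → β → EuclideanSpace ℝ κ) (r : EuclideanSpace ℝ κ)
    (R : ℝ) (hv : ∀ a b, ‖v a b‖ ^ 2 ≤ R)
    (hr : ∀ i, ∫ x, ∑ a, v a (x a) i ∂Measure.pi μ = r i) :
    ∫ x, ‖∑ a, v a (x a) - r‖ ∂Measure.pi μ ≤ √(Fintype.card α * R) := by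
  have hL2 : ∀ f : (α → β) → ℝ, MemLp f 2 (Measure.pi μ) := fun f => MemLp.of_discrete
  have hvar : ∀ i, ∫ x, (∑ a, v a (x a) i - r i) ^ 2 ∂Measure.pi μ ≤
      ∑ a, ∫ b, (v a b i) ^ 2 ∂μ a := by
    intro i
    have h1 : ∫ x, (∑ a, v a (x a) i - r i) ^ 2 ∂Measure.pi μ =
        Var[∑ a, fun x : α → β => v a (x a) i; Measure.pi μ] := by
      rw [variance_eq_integral Measurable.of_discrete.aemeasurable]
      simp only [Finset.sum_apply, hr]
    have hind := iIndepFun_pi (μ := μ) (X := fun a b => v a b i)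
      fun a => Measurable.of_discrete.aemeasurable
    rw [h1, IndepFun.variance_sum (fun a _ => hL2 _) fun a _ b _ hab => hind.indepFun hab]
    refine Finset.sum_le_sum fun a _ => ?_
    refine (variance_le_expectation_sq Measurable.of_discrete.aestronglyMeasurable).trans ?_
    exact le_of_eq (integral_comp_eval (μ := μ) (i := a) (f := fun b => (v a b i) ^ 2)
      Measurable.of_discrete.aestronglyMeasurable)
  have hsq : ∫ x, ‖∑ a, v a (x a) - r‖ ^ 2 ∂Measure.pi μ ≤ Fintype.card α * R := by
    have h1 : ∀ x : α → β, ‖∑ a, v a (x a) - r‖ ^ 2 = ∑ i, (∑ a, v a (x a) i - r i) ^ 2 := by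
      intro x
      rw [EuclideanSpace.norm_sq_eq]
      simp
    simp only [h1]
    rw [integral_finsetSum _ fun i _ => Integrable.of_finite]
    calc ∑ i, ∫ x, (∑ a, v a (x a) i - r i) ^ 2 ∂Measure.pi μ
        ≤ ∑ i, ∑ a, ∫ b, (v a b i) ^ 2 ∂μ a := Finset.sum_le_sum fun i _ => hvar i
      _ = ∑ a, ∫ b, ‖v a b‖ ^ 2 ∂μ a := by
          rw [Finset.sum_comm]
          refine Finset.sum_congr rfl fun a _ => ?_
          rw [← integral_finsetSum _ fun i _ => Integrable.of_finite]
          congr 1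
          funext b
          rw [EuclideanSpace.norm_sq_eq]
          simp
      _ ≤ ∑ _a : α, R := by
          refine Finset.sum_le_sum fun a _ => ?_
          have := integral_mono (μ := μ a) (f := fun b => ‖v a b‖ ^ 2) (g := fun _ => R)
            Integrable.of_finite Integrable.of_finite (hv a)
          simpa using this
      _ = Fintype.card α * R := by simp
  refine Real.le_sqrt_of_sq_le (le_trans ?_ hsq)
  have hvar0 := variance_nonneg (fun x : α → β => ‖∑ a, v a (x a) - r‖) (Measure.pi μ)
  rw [variance_eq_sub (hL2 _)] at hvar0
  simp only [Pi.pow_apply] at hvar0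
  linarith

/-- The norm of a sum of independent random vectors of norm at most `√R` deviates from its mean
by more than `(1 + s) √(T R)` with probability at most `exp (-s² / 2)`, where `T` is
the number of summands. -/
theorem vector_concentration {κ : Type} [Fintype κ] (μ : α → Measure β)
    [∀ a, IsProbabilityMeasure (μ a)] (v : α → β → EuclideanSpace ℝ κ) (r : EuclideanSpace ℝ κ)
    (R : ℝ) (hv : ∀ a b, ‖v a b‖ ^ 2 ≤ R)
    (hr : ∀ i, ∫ x, ∑ a, v a (x a) i ∂Measure.pi μ = r i) (hR : 0 < Fintype.card α * R) (s : ℝ)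
    (hs : 0 ≤ s) :
    (Measure.pi μ).real {x | √(Fintype.card α * R) * (1 + s) ≤ ‖∑ a, v a (x a) - r‖} ≤
      Real.exp (-s ^ 2 / 2) := by
  set B := Fintype.card α * R with hB
  have hv' : ∀ a b, ‖v a b‖ ≤ √R := fun a b => Real.le_sqrt_of_sq_le (hv a b)
  have hR0 : 0 ≤ R := by
    by_contra h
    have : (Fintype.card α : ℝ) * R ≤ 0 :=
      mul_nonpos_of_nonneg_of_nonpos (Nat.cast_nonneg _) (not_le.mp h).le
    linarith
  have hbd : ∀ (x : α → β) a b, |‖∑ a, v a (x a) - r‖ -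
      ‖∑ a', v a' (Function.update x a b a') - r‖| ≤ 2 * √R := by
    intro x a b
    refine (abs_norm_sub_norm_le _ _).trans ?_
    have h1 : ∑ a, v a (x a) - r - (∑ a', v a' (Function.update x a b a') - r) =
        v a (x a) - v a b := by
      rw [sub_sub_sub_cancel_right, ← Finset.sum_sub_distrib, Finset.sum_eq_single a]
      · rw [Function.update_self]
      · intro a' _ ha'
        rw [Function.update_of_ne ha', sub_self]
      · simp
    rw [h1]
    exact (norm_sub_le _ _).trans (by linarith [hv' a (x a), hv' a b])
  have hmean := integral_norm_sum_sub_le μ v r R hv hr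
  have hmc := mcdiarmid μ (fun _ => 2 * √R) (fun x => ‖∑ a, v a (x a) - r‖) hbd (√B * s)
    (by positivity)
  refine le_trans (measureReal_mono ?_) (hmc.trans (le_of_eq ?_))
  · intro x hx
    simp only [Set.mem_ofPred_eq] at hx ⊢
    linarith
  · congr 1
    have h2 : ∑ _a : α, (2 * √R / 2) ^ 2 = B := by
      simp [hB, Real.sq_sqrt hR0]
    rw [h2, mul_pow, Real.sq_sqrt hR.le]
    field_simp

end Concentration

/-! ### Informative settings -/

section Informative

open scoped Classical

variable {k : ℕ}

/-- Conjugation by `U` turns the string `p` into a signed string of `I`s and `Z`s. -/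
def Diagonalizes (U : Op (Fin k)) (p : Fin k → Fin 4) : Prop :=
  IsSignedZString (U * pauliString p * Uᴴ)

lemma diagonalizes_iff {U : Op (Fin k)} (hU : IsClifford U) (p : Fin k → Fin 4) :
    Diagonalizes U p ↔ ZType (hU.act p) := isSignedZString_conj_iff hU p

lemma diagonalizes_zero {U : Op (Fin k)} (hU : IsClifford U) : Diagonalizes U 0 := by
  rw [diagonalizes_iff hU, hU.act_zero]
  exact fun _ => Or.inl rfl

lemma card_zType : (Finset.univ.filter fun p : Fin k → Fin 4 => ZType p).card = 2 ^ k := by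
  have : (Finset.univ.filter fun p : Fin k → Fin 4 => ZType p) =
      Fintype.piFinset fun _ : Fin k => ({0, 3} : Finset (Fin 4)) := by
    ext p
    rw [Finset.mem_filter, Fintype.mem_piFinset]
    simp only [Finset.mem_univ, true_and, ZType, Finset.mem_insert, Finset.mem_singleton]
  rw [this, Fintype.card_piFinset]
  simp

lemma card_diagonalized {U : Op (Fin k)} (hU : IsClifford U) :
    (Finset.univ.filter fun p => Diagonalizes U p).card = 2 ^ k := by
  rw [← card_zType (k := k)]
  refine Finset.card_bij (fun p _ => hU.act p) (fun p hp => ?_)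
    (fun p _ q _ h => hU.act.injective h) fun q hq => ⟨hU.act.symm q, ?_, ?_⟩
  · rw [Finset.mem_filter] at hp ⊢
    exact ⟨Finset.mem_univ _, (diagonalizes_iff hU p).mp hp.2⟩
  · rw [Finset.mem_filter] at hq ⊢
    refine ⟨Finset.mem_univ _, (diagonalizes_iff hU _).mpr ?_⟩
    rw [Equiv.apply_symm_apply]
    exact hq.2
  · exact Equiv.apply_symm_apply _ _

/-- The stabilizer groups of two mutually unbiased bases intersect trivially: the overlaps do
not vanish, so a string that is diagonal in both bases has only one eigenvalue. -/
lemma eq_zero_of_diagonalizes {U : Fin (2 ^ k + 1) → Op (Fin k)} (hU : IsStabilizerMUB U)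
    {j j' : Fin (2 ^ k + 1)} (hj : j ≠ j') {p : Fin k → Fin 4} (h : Diagonalizes (U j) p)
    (h' : Diagonalizes (U j') p) : p = 0 := by
  have hC := hU.clifford j
  have hC' := hU.clifford j'
  rw [diagonalizes_iff hC] at h
  rw [diagonalizes_iff hC'] at h'
  set W := U j * (U j')ᴴ with hWdef
  have hW : IsClifford W := hC.mul hC'.conjTranspose
  have hne : ∀ b b', W b b' ≠ 0 := by
    intro b b' h0
    have := hU.unbiased j j' hj b b'
    rw [← hWdef, h0] at this
    have h2 : (0 : ℝ) < 1 / 2 ^ k := by positivity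
    rw [← this] at h2
    simp at h2
  obtain ⟨c, hc⟩ := (hC'.maps_conjTranspose p).comp (hC.maps_act p)
  set Q := hC'.act p with hQ
  have h1 : W * pauliString Q = c • (pauliString (hC.act p) * W) := by
    rw [← Matrix.smul_mul, ← hc, ← hWdef, Matrix.mul_assoc _ Wᴴ, hW.conjTranspose_mul,
      Matrix.mul_one]
  have h2 : ∀ a b, pauliString Q b b = c * pauliString (hC.act p) a a := by
    intro a b
    have := congrFun (congrFun h1 a) b
    rw [Matrix.smul_apply, Matrix.mul_apply, Matrix.mul_apply, Finset.sum_eq_single b,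
      Finset.sum_eq_single a, smul_eq_mul] at this
    · refine mul_left_cancel₀ (hne a b) (this.trans ?_)
      ring
    · intro y _ hy
      rw [pauliString_offDiag h (Ne.symm hy), zero_mul]
    · simp
    · intro y _ hy
      rw [pauliString_offDiag h' hy, mul_zero]
    · simp
  have h3 : pauliString Q = (pauliString Q 0 0) • pauliString 0 := by
    ext a b
    rw [Matrix.smul_apply, pauliString_zero]
    by_cases hab : a = b
    · subst hab
      rw [Matrix.one_apply_eq, smul_eq_mul, mul_one, h2 0 a, h2 0 0]
    · rw [pauliString_offDiag h' hab, Matrix.one_apply_ne hab, smul_zero]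
  have h4 : Q = 0 := eq_of_pauliString_eq_smul h3
  rw [hQ, ← hC'.act_zero] at h4
  exact hC'.act.injective h4

/-- The number of bases of the family that diagonalize a given string. -/
def numBases (U : Fin (2 ^ k + 1) → Op (Fin k)) (p : Fin k → Fin 4) : ℕ :=
  (Finset.univ.filter fun j => Diagonalizes (U j) p).card

lemma numBases_zero {U : Fin (2 ^ k + 1) → Op (Fin k)} (hU : IsStabilizerMUB U) :
    numBases U 0 = 2 ^ k + 1 := by
  rw [numBases, Finset.filter_true_of_mem fun j _ => diagonalizes_zero (hU.clifford j)]
  simp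

/-- The `2 ^ k + 1` groups, each with `2 ^ k - 1` nontrivial strings, partition the `4 ^ k - 1`
nontrivial strings. -/
lemma numBases_of_ne_zero {U : Fin (2 ^ k + 1) → Op (Fin k)} (hU : IsStabilizerMUB U)
    {p : Fin k → Fin 4} (hp : p ≠ 0) : numBases U p = 1 := by
  have hle : ∀ p ∈ Finset.univ.erase (0 : Fin k → Fin 4), numBases U p ≤ 1 := by
    intro p hp
    refine Finset.card_le_one.mpr fun j hj j' hj' => ?_
    by_contra hne
    exact Finset.ne_of_mem_erase hp (eq_zero_of_diagonalizes hU hne (Finset.mem_filter.mp hj).2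
      (Finset.mem_filter.mp hj').2)
  have htotal : ∑ p, numBases U p = (2 ^ k + 1) * 2 ^ k := by
    simp only [numBases, Finset.card_filter]
    rw [Finset.sum_comm]
    simp only [← Finset.card_filter, fun j => card_diagonalized (hU.clifford j)]
    simp
  have hsum : ∑ p ∈ Finset.univ.erase (0 : Fin k → Fin 4), numBases U p =
      ∑ p ∈ Finset.univ.erase (0 : Fin k → Fin 4), 1 := by
    have h1 := Finset.add_sum_erase Finset.univ (numBases U)
      (Finset.mem_univ (0 : Fin k → Fin 4))
    rw [htotal, numBases_zero hU] at h1
    have h2 := Finset.add_sum_erase Finset.univ (fun _ : Fin k → Fin 4 => 1)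
      (Finset.mem_univ 0)
    have h3 : ∑ _p : Fin k → Fin 4, 1 = 2 ^ k * 2 ^ k := by
      simp [← mul_pow]
    rw [h3] at h2
    generalize ∑ p ∈ Finset.univ.erase (0 : Fin k → Fin 4), numBases U p = x at *
    generalize ∑ p ∈ Finset.univ.erase (0 : Fin k → Fin 4), 1 = y at *
    rw [add_mul, one_mul] at h1
    omega
  exact (Finset.sum_eq_sum_iff_of_le hle).mp hsum p (Finset.mem_erase.mpr ⟨hp, Finset.mem_univ p⟩)

lemma numBases_pos {U : Fin (2 ^ k + 1) → Op (Fin k)} (hU : IsStabilizerMUB U)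
    (p : Fin k → Fin 4) : 0 < numBases U p := by
  by_cases hp : p = 0
  · rw [hp, numBases_zero hU]
    exact Nat.succ_pos _
  · rw [numBases_of_ne_zero hU hp]
    exact one_pos

/-- The second moment of one block: there are `2 ^ k - 1` informative nontrivial strings, and the
trivial string is down-weighted by the number of bases. -/
lemma sum_inv_numBases_le {U : Fin (2 ^ k + 1) → Op (Fin k)} (hU : IsStabilizerMUB U)
    (j : Fin (2 ^ k + 1)) :
    ∑ p, (if Diagonalizes (U j) p then (1 / (numBases U p : ℝ) ^ 2) else 0) ≤
      (2 ^ k) ^ 2 / (2 ^ k + 1) := by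
  have h0 := diagonalizes_zero (hU.clifford j)
  rw [← Finset.add_sum_erase _ _ (Finset.mem_univ 0), if_pos h0, numBases_zero hU]
  have h1 : ∑ p ∈ Finset.univ.erase (0 : Fin k → Fin 4),
      (if Diagonalizes (U j) p then (1 / (numBases U p : ℝ) ^ 2) else 0) = 2 ^ k - 1 := by
    have h2 : ∀ p ∈ Finset.univ.erase (0 : Fin k → Fin 4),
        (if Diagonalizes (U j) p then (1 / (numBases U p : ℝ) ^ 2) else 0) =
          if Diagonalizes (U j) p then 1 else 0 := by
      intro p hp
      rw [numBases_of_ne_zero hU (Finset.ne_of_mem_erase hp)]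
      simp
    rw [Finset.sum_congr rfl h2, eq_sub_iff_add_eq, add_comm]
    have h3 := Finset.add_sum_erase Finset.univ
      (fun p => if Diagonalizes (U j) p then (1 : ℝ) else 0) (Finset.mem_univ 0)
    rw [if_pos h0] at h3
    rw [h3, ← Finset.sum_filter, Finset.sum_const, card_diagonalized (hU.clifford j)]
    simp
  rw [h1]
  push_cast
  have hq : (0 : ℝ) < 2 ^ k := by positivity
  generalize (2 : ℝ) ^ k = q at hq
  rw [div_add' _ _ _ (by positivity), div_le_div_iff₀ (by positivity) (by positivity)]
  nlinarith [mul_pos hq hq, mul_pos (mul_pos hq hq) hq]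

variable {m : ℕ} {U : Fin m → Fin (2 ^ k + 1) → Op (Fin k)}

lemma informative_iff (hU : ∀ i, IsStabilizerMUB (U i)) (P : Fin m × Fin k → Fin 4)
    (j : Setting m k) : Informative U P j ↔ ∀ i, Diagonalizes (U i (j i)) (row P i) := by
  have hC := fun i => (hU i).clifford (j i)
  have h := isSignedZString_conj_iff (blockTensor_isClifford hC) P
  unfold Informative settingUnitary
  rw [h]
  simp only [fun i => diagonalizes_iff (hC i), ZType, Prod.forall, act_blockTensor hC]

lemma numInformative_eq (hU : ∀ i, IsStabilizerMUB (U i)) (P : Fin m × Fin k → Fin 4) :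
    numInformative U P = ∏ i, numBases (U i) (row P i) := by
  have : (Finset.univ.filter fun j => Informative U P j) =
      Fintype.piFinset fun i => Finset.univ.filter fun j => Diagonalizes (U i j) (row P i) := by
    ext j
    simp [informative_iff hU]
  rw [numInformative, this, Fintype.card_piFinset]
  rfl

lemma numInformative_pos (hU : ∀ i, IsStabilizerMUB (U i)) (P : Fin m × Fin k → Fin 4) :
    0 < numInformative U P := by
  rw [numInformative_eq hU]
  exact Finset.prod_pos fun i _ => numBases_pos (hU i) _

lemma sum_inv_numInformative_le (hU : ∀ i, IsStabilizerMUB (U i)) (j : Setting m k) :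
    ∑ P, (if Informative U P j then (1 / (numInformative U P : ℝ) ^ 2) else 0) ≤
      ((2 ^ k) ^ 2 / (2 ^ k + 1)) ^ m := by
  have h1 : ∀ P, (if Informative U P j then (1 / (numInformative U P : ℝ) ^ 2) else 0) =
      ∏ i, if Diagonalizes (U i (j i)) (row P i) then
        (1 / (numBases (U i) (row P i) : ℝ) ^ 2) else 0 := by
    intro P
    rw [Finset.prod_ite_zero]
    simp only [informative_iff hU, numInformative_eq hU, Finset.mem_univ, true_imp_iff]
    congr 1
    push_cast
    rw [Finset.prod_div_distrib, Finset.prod_const_one, Finset.prod_pow]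
  simp only [h1]
  rw [← (Equiv.curry (Fin m) (Fin k) (Fin 4)).symm.sum_comp]
  have h2 := Finset.prod_univ_sum (fun _ : Fin m => (Finset.univ : Finset (Fin k → Fin 4)))
    fun i p => if Diagonalizes (U i (j i)) p then (1 / (numBases (U i) p : ℝ) ^ 2) else 0
  rw [Fintype.piFinset_univ] at h2
  refine (le_of_eq h2.symm).trans ?_
  calc _ ≤ ∏ _i : Fin m, ((2 ^ k) ^ 2 / (2 ^ k + 1) : ℝ) := by
        refine Finset.prod_le_prod (fun i _ => Finset.sum_nonneg fun p _ => ?_) fun i _ =>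
          sum_inv_numBases_le (hU i) (j i)
        split_ifs <;> positivity
    _ = _ := by simp [div_pow]

end Informative

/-! ### Born probabilities -/

section Born

variable {ι : Type} [Fintype ι] [DecidableEq ι]

lemma bornProb_nonneg (U : Op ι) {ρ : Op ι} (hρ : IsDensityMatrix ρ) (b : Bits ι) :
    0 ≤ bornProb U ρ b := by
  have h : (U * ρ * Uᴴ).PosSemidef := hρ.1.mul_mul_conjTranspose_same U
  exact (Complex.nonneg_iff.mp h.diag_nonneg).1

lemma sum_bornProb {U ρ : Op ι} (hU : IsClifford U) (hρ : IsDensityMatrix ρ) :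
    ∑ b, bornProb U ρ b = 1 := by
  have h : (U * ρ * Uᴴ).trace = 1 := by
    rw [Matrix.trace_mul_comm, ← Matrix.mul_assoc, hU.conjTranspose_mul, Matrix.one_mul, hρ.2]
  simp only [bornProb]
  rw [← Complex.re_sum]
  exact congrArg Complex.re h

lemma isProbabilityMeasure_bornMeasure {U ρ : Op ι} (hU : IsClifford U)
    (hρ : IsDensityMatrix ρ) : IsProbabilityMeasure (bornMeasure U ρ) := by
  constructor
  simp only [bornMeasure, Measure.coe_finsetSum, Finset.sum_apply, Measure.smul_apply,
    measure_univ, smul_eq_mul, mul_one]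
  rw [← ENNReal.ofReal_sum_of_nonneg fun b _ => bornProb_nonneg U hρ b, sum_bornProb hU hρ,
    ENNReal.ofReal_one]

lemma integral_bornMeasure {U ρ : Op ι} (hρ : IsDensityMatrix ρ)
    (f : Bits ι → ℝ) : ∫ b, f b ∂bornMeasure U ρ = ∑ b, bornProb U ρ b * f b := by
  rw [bornMeasure, integral_finsetSum_measure]
  · refine Finset.sum_congr rfl fun b _ => ?_
    rw [integral_smul_measure, integral_dirac, ENNReal.toReal_ofReal (bornProb_nonneg U hρ b),
      smul_eq_mul]
  · intro b _
    exact (Integrable.of_finite (μ := Measure.dirac b)).smul_measure ENNReal.ofReal_ne_top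

/-- Measuring a basis in which `P` is diagonal gives the expectation of `P`. -/
lemma integral_pauli_value {U ρ : Op ι} (hU : IsClifford U) (hρ : IsDensityMatrix ρ)
    {P : ι → Fin 4} (hP : IsSignedZString (U * pauliString P * Uᴴ)) :
    ∫ b, ((U * pauliString P * Uᴴ) b b).re ∂bornMeasure U ρ = (pauliString P * ρ).trace.re := by
  rw [integral_bornMeasure hρ]
  have hoff : ∀ b c, b ≠ c → (U * pauliString P * Uᴴ) b c = 0 := by
    obtain ⟨Q, hQ, h | h⟩ := hP <;> intro b c hbc <;> rw [h]
    · exact pauliString_offDiag hQ hbc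
    · rw [Matrix.neg_apply, pauliString_offDiag hQ hbc, neg_zero]
  have hherm : (U * pauliString P * Uᴴ)ᴴ = U * pauliString P * Uᴴ := by
    simp [Matrix.conjTranspose_mul, Matrix.mul_assoc]
  have htr : (pauliString P * ρ).trace =
      ((U * ρ * Uᴴ) * (U * pauliString P * Uᴴ)).trace := by
    rw [conj_mul_conj hU.conjTranspose_mul, Matrix.trace_mul_comm (U * _), ← Matrix.mul_assoc Uᴴ,
      hU.conjTranspose_mul, Matrix.one_mul, Matrix.trace_mul_comm]
  rw [htr]
  generalize U * pauliString P * Uᴴ = A at *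
  simp only [Matrix.trace, Matrix.diag]
  rw [Complex.re_sum]
  refine Finset.sum_congr rfl fun b _ => ?_
  rw [Matrix.mul_apply, Finset.sum_eq_single b]
  · have him : (A b b).im = 0 := by
      have := congrFun (congrFun hherm b) b
      rw [Matrix.conjTranspose_apply] at this
      exact Complex.conj_eq_iff_im.mp this
    rw [Complex.mul_re, him, mul_zero, sub_zero, bornProb]
  · intro c _ hc
    rw [hoff c b hc, mul_zero]
  · simp

lemma trace_pauli_mul_density_real {ρ : Op ι} (hρ : IsDensityMatrix ρ) (P : ι → Fin 4) :
    (((pauliString P * ρ).trace.re : ℝ) : ℂ) = (pauliString P * ρ).trace := by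
  apply Complex.conj_eq_iff_re.mp
  have h := Matrix.trace_conjTranspose (pauliString P * ρ)
  rw [Matrix.conjTranspose_mul, pauliString_conjTranspose, hρ.1.isHermitian.eq,
    Matrix.trace_mul_comm] at h
  exact h.symm

/-- The trace norm is at most `√d` times the Frobenius norm. -/
lemma traceNorm_sum_le (c : (ι → Fin 4) → ℝ) :
    traceNorm (∑ P, (c P : ℂ) • pauliString P) ≤ 2 ^ Fintype.card ι * √(∑ P, c P ^ 2) := by
  set A : Op ι := ∑ P, (c P : ℂ) • pauliString P with hA
  set hH := Matrix.isHermitian_conjTranspose_mul_self A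
  have hnn : ∀ i, 0 ≤ hH.eigenvalues i :=
    (Matrix.posSemidef_conjTranspose_mul_self A).eigenvalues_nonneg
  have htr : (Aᴴ * A).trace = ((2 ^ Fintype.card ι * ∑ P, c P ^ 2 : ℝ) : ℂ) := by
    have hAH : Aᴴ = A := by
      simp [hA, Matrix.conjTranspose_sum, Matrix.conjTranspose_smul]
    rw [hAH, hA, Finset.sum_mul]
    simp only [Finset.mul_sum, Matrix.smul_mul, Matrix.mul_smul, Matrix.trace_sum,
      Matrix.trace_smul, trace_pauliString_mul, smul_eq_mul, mul_ite, mul_zero,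
      Finset.sum_ite_eq, Finset.mem_univ, if_true]
    push_cast
    refine Finset.sum_congr rfl fun P _ => ?_
    ring
  have hsum : ∑ i, hH.eigenvalues i = 2 ^ Fintype.card ι * ∑ P, c P ^ 2 := by
    have h := hH.trace_eq_sum_eigenvalues
    rw [htr] at h
    apply Complex.ofReal_injective
    rw [h]
    push_cast
    rfl
  have hcard : (Fintype.card (Bits ι) : ℝ) = 2 ^ Fintype.card ι := by simp
  have hcs : (∑ i, √(hH.eigenvalues i)) ^ 2 ≤
      Fintype.card (Bits ι) * ∑ i, √(hH.eigenvalues i) ^ 2 := by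
    have := sq_sum_le_card_mul_sum_sq (s := (Finset.univ : Finset (Bits ι)))
      (f := fun i => √(hH.eigenvalues i))
    simpa using this
  simp only [fun i => Real.sq_sqrt (hnn i)] at hcs
  rw [hsum, hcard] at hcs
  have hfin : traceNorm A ^ 2 ≤ (2 ^ Fintype.card ι * √(∑ P, c P ^ 2)) ^ 2 := by
    refine hcs.trans (le_of_eq ?_)
    rw [mul_pow, Real.sq_sqrt (Finset.sum_nonneg fun P _ => sq_nonneg _)]
    ring
  exact le_of_sq_le_sq hfin (by positivity)

end Born

/-! ### The estimator -/

section Estimator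

open scoped Classical

variable {m k M : ℕ} {U : Fin m → Fin (2 ^ k + 1) → Op (Fin k)}
  {ρ : Op (Fin m × Fin k)}

lemma settingUnitary_isClifford (hU : ∀ i, IsStabilizerMUB (U i)) (j : Setting m k) :
    IsClifford (settingUnitary U j) :=
  blockTensor_isClifford fun i => (hU i).clifford (j i)

/-- The contribution of the outcome `b` of one measurement in the setting `j` to the Pauli
coefficients of the estimator. -/
def contribution (U : Fin m → Fin (2 ^ k + 1) → Op (Fin k)) (M : ℕ) (j : Setting m k)
    (b : Bits (Fin m × Fin k)) : EuclideanSpace ℝ (Fin m × Fin k → Fin 4) :=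
  WithLp.toLp 2 fun P => if Informative U P j then
    pauliValue U P j b / (2 ^ (m * k) * M * numInformative U P) else 0

/-- The Pauli coefficients of `ρ`. -/
def coefficients (ρ : Op (Fin m × Fin k)) : EuclideanSpace ℝ (Fin m × Fin k → Fin 4) :=
  WithLp.toLp 2 fun P => (pauliString P * ρ).trace.re / 2 ^ (m * k)

lemma estimator_eq (x : Data m k M) :
    estimator U x =
      ∑ P, ((∑ a, contribution U M a.1 (x a) P : ℝ) : ℂ) • pauliString P := by
  refine Finset.sum_congr rfl fun P _ => ?_
  congr 2
  rw [pauliSum, Finset.sum_div]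
  refine Finset.sum_congr rfl fun a _ => ?_
  simp only [contribution]
  split_ifs <;> simp

lemma density_eq (hρ : IsDensityMatrix ρ) :
    ρ = ∑ P, ((coefficients ρ P : ℝ) : ℂ) • pauliString P := by
  conv_lhs => rw [pauli_expansion ρ]
  refine Finset.sum_congr rfl fun P _ => ?_
  simp only [coefficients]
  rw [Complex.ofReal_div, trace_pauli_mul_density_real hρ]
  simp

lemma traceNorm_estimator_sub_le (hρ : IsDensityMatrix ρ) (x : Data m k M) :
    traceNorm (estimator U x - ρ) ≤
      2 ^ (m * k) * ‖∑ a, contribution U M a.1 (x a) - coefficients ρ‖ := by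
  have h := traceNorm_sum_le fun P => ∑ a, contribution U M a.1 (x a) P - coefficients ρ P
  have h1 : estimator U x - ρ = ∑ P : Fin m × Fin k → Fin 4,
      ((∑ a, contribution U M a.1 (x a) P - coefficients ρ P : ℝ) : ℂ) • pauliString P := by
    conv_lhs => rw [estimator_eq, density_eq hρ]
    rw [← Finset.sum_sub_distrib]
    refine Finset.sum_congr rfl fun P _ => ?_
    rw [Complex.ofReal_sub, sub_smul]
  rw [h1]
  refine h.trans (le_of_eq ?_)
  rw [EuclideanSpace.norm_eq]
  simp

lemma isProbabilityMeasure_outcome (hU : ∀ i, IsStabilizerMUB (U i)) (hρ : IsDensityMatrix ρ)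
    (a : Setting m k × Fin M) : IsProbabilityMeasure (bornMeasure (settingUnitary U a.1) ρ) :=
  isProbabilityMeasure_bornMeasure (settingUnitary_isClifford hU a.1) hρ

/-- The coefficients of the estimator have the coefficients of `ρ` as means: each of
the `M * N_P > 0` informative outcomes has the expectation of `P` in `ρ` as its mean. -/
lemma integral_contribution (hU : ∀ i, IsStabilizerMUB (U i)) (hρ : IsDensityMatrix ρ)
    (hM : 0 < M) (P : Fin m × Fin k → Fin 4) :
    ∫ x, ∑ a, contribution U M a.1 (x a) P ∂experiment U M ρ = coefficients ρ P := by
  have := isProbabilityMeasure_outcome (M := M) hU hρ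
  have h1 : ∀ a : Setting m k × Fin M,
      ∫ x, contribution U M a.1 (x a) P ∂experiment U M ρ =
        if Informative U P a.1 then
          (pauliString P * ρ).trace.re / (2 ^ (m * k) * M * numInformative U P) else 0 := by
    intro a
    rw [experiment, integral_comp_eval
      (μ := fun a : Setting m k × Fin M => bornMeasure (settingUnitary U a.1) ρ) (i := a)
      (f := fun b => contribution U M a.1 b P) Measurable.of_discrete.aestronglyMeasurable]
    simp only [contribution]
    split_ifs with h
    · rw [integral_div]
      congr 1
      exact integral_pauli_value (settingUnitary_isClifford hU a.1) hρ h
    · simp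
  have hprob : IsProbabilityMeasure (experiment U M ρ) := by
    rw [experiment]
    infer_instance
  rw [integral_finsetSum _ fun a _ => Integrable.of_finite]
  simp only [h1]
  rw [Fintype.sum_prod_type]
  refine (Finset.sum_congr rfl fun j _ => Finset.sum_const (s := (Finset.univ : Finset (Fin M)))
    (if Informative U P j then
      (pauliString P * ρ).trace.re / (2 ^ (m * k) * M * numInformative U P) else 0)).trans ?_
  rw [← Finset.smul_sum, ← Finset.sum_filter, Finset.sum_const, Finset.card_univ,
    Fintype.card_fin, nsmul_eq_mul, nsmul_eq_mul]
  have hN : (0 : ℝ) < numInformative U P := Nat.cast_pos.mpr (numInformative_pos hU P)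
  have hM' : (0 : ℝ) < M := Nat.cast_pos.mpr hM
  have hcard : ((Finset.univ.filter fun j => Informative U P j).card : ℝ) = numInformative U P :=
    rfl
  rw [hcard]
  simp only [coefficients]
  field_simp

lemma norm_contribution_sq_le (hU : ∀ i, IsStabilizerMUB (U i)) (j : Setting m k)
    (b : Bits (Fin m × Fin k)) :
    ‖contribution U M j b‖ ^ 2 ≤
      ((2 ^ k) ^ 2 / (2 ^ k + 1)) ^ m / (2 ^ (m * k) * M) ^ 2 := by
  have hval : ∀ P, Informative U P j → pauliValue U P j b ^ 2 ≤ 1 := by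
    intro P hP
    rw [sq_le_one_iff_abs_le_one]
    refine (Complex.abs_re_le_norm _).trans ?_
    obtain ⟨Q, -, h | h⟩ := hP <;> rw [h]
    · exact norm_pauliString_le Q b b
    · rw [Matrix.neg_apply, norm_neg]
      exact norm_pauliString_le Q b b
  rw [EuclideanSpace.norm_sq_eq]
  calc ∑ P, ‖contribution U M j b P‖ ^ 2
      ≤ ∑ P, (if Informative U P j then (1 / (numInformative U P : ℝ) ^ 2) else (0 : ℝ)) /
          ((2 : ℝ) ^ (m * k) * M) ^ 2 := by
        refine Finset.sum_le_sum fun P _ => ?_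
        rw [Real.norm_eq_abs, sq_abs]
        simp only [contribution]
        split_ifs with h
        · rw [div_pow, mul_pow _ (numInformative U P : ℝ), ← div_div, div_right_comm]
          gcongr
          exact hval P h
        · simp
    _ ≤ _ := by
        rw [← Finset.sum_div]
        gcongr
        exact sum_inv_numInformative_le hU j

theorem integral_estimator (hU : ∀ i, IsStabilizerMUB (U i)) (hρ : IsDensityMatrix ρ)
    (hM : 0 < M) (s t : Bits (Fin m × Fin k)) :
    Integrable (fun x => estimator U x s t) (experiment U M ρ) ∧
      ∫ x, estimator U x s t ∂experiment U M ρ = ρ s t := by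
  have := isProbabilityMeasure_outcome (M := M) hU hρ
  have hprob : IsProbabilityMeasure (experiment U M ρ) := by
    rw [experiment]
    infer_instance
  refine ⟨Integrable.of_finite, ?_⟩
  have h1 : ∀ x : Data m k M, estimator U x s t =
      ∑ P, ((∑ a, contribution U M a.1 (x a) P : ℝ) : ℂ) * pauliString P s t := by
    intro x
    rw [estimator_eq]
    simp only [Matrix.sum_apply, Matrix.smul_apply, smul_eq_mul]
  simp only [h1]
  rw [integral_finsetSum _ fun P _ => Integrable.of_finite]
  conv_rhs => rw [density_eq hρ]
  simp only [Matrix.sum_apply, Matrix.smul_apply, smul_eq_mul]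
  refine Finset.sum_congr rfl fun P _ => ?_
  rw [integral_mul_const, integral_complex_ofReal, integral_contribution hU hρ hM]

/-- The trace norm error exceeds `d (1 + s) / √M` with probability at most `exp (-s² / 2)`. -/
theorem estimator_concentration (hU : ∀ i, IsStabilizerMUB (U i)) (hρ : IsDensityMatrix ρ)
    (hM : 0 < M) {ε s : ℝ} (hs : 0 ≤ s) (hε : 2 ^ (m * k) * (√(1 / M) * (1 + s)) ≤ ε) :
    experiment U M ρ {x | ε ≤ traceNorm (estimator U x - ρ)} ≤
      ENNReal.ofReal (Real.exp (-s ^ 2 / 2)) := by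
  have := isProbabilityMeasure_outcome (M := M) hU hρ
  have hM' : (0 : ℝ) < M := Nat.cast_pos.mpr hM
  set R : ℝ := ((2 ^ k) ^ 2 / (2 ^ k + 1)) ^ m / (2 ^ (m * k) * M) ^ 2 with hR
  have hTR : (Fintype.card (Setting m k × Fin M) : ℝ) * R = 1 / M := by
    have h1 : (2 : ℝ) ^ (m * k) = (2 ^ k) ^ m := by rw [mul_comm, pow_mul]
    rw [hR, h1, Fintype.card_prod, Fintype.card_fin, Fintype.card_pi]
    simp only [Fintype.card_fin, Finset.prod_const, Finset.card_univ]
    push_cast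
    have hq : (0 : ℝ) < 2 ^ k := by positivity
    rw [div_pow, mul_pow, pow_right_comm]
    field_simp
  have h := vector_concentration
    (fun a : Setting m k × Fin M => bornMeasure (settingUnitary U a.1) ρ)
    (fun a b => contribution U M a.1 b) (coefficients ρ) R
    (fun a b => norm_contribution_sq_le hU a.1 b) (fun P => integral_contribution hU hρ hM P)
    (by rw [hTR]; positivity) s hs
  rw [hTR] at h
  have hsub : {x : Data m k M | ε ≤ traceNorm (estimator U x - ρ)} ⊆
      {x | √(1 / M) * (1 + s) ≤ ‖∑ a, contribution U M a.1 (x a) - coefficients ρ‖} := by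
    intro x hx
    have h1 : ε ≤ _ := le_trans hx (traceNorm_estimator_sub_le hρ x)
    exact le_of_mul_le_mul_left (hε.trans h1) (by positivity)
  refine (measure_mono hsub).trans ?_
  have hprob : IsProbabilityMeasure (experiment U M ρ) := by
    rw [experiment]
    infer_instance
  rw [← ofReal_measureReal]
  exact ENNReal.ofReal_le_ofReal h

end Estimator

/-- For `n = m k ≤ k 2 ^ k` the number of settings exceeds `d = 2 ^ n` by a factor
`(1 + 2 ^ (-k)) ^ m ≤ e` at most. -/
lemma settings_le {m k : ℕ} (hk : 0 < k) (h : m * k ≤ k * 2 ^ k) :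
    ((2 : ℝ) ^ k + 1) ^ m ≤ 3 * 2 ^ (m * k) := by
  have hm : m ≤ 2 ^ k := by
    rw [mul_comm m k] at h
    exact Nat.le_of_mul_le_mul_left h hk
  have hm' : (m : ℝ) ≤ 2 ^ k := by exact_mod_cast hm
  have hq : (0 : ℝ) < 2 ^ k := by positivity
  have h1 : (2 : ℝ) ^ k + 1 ≤ 2 ^ k * Real.exp (1 / 2 ^ k) := by
    have h2 := Real.add_one_le_exp (1 / (2 : ℝ) ^ k)
    calc (2 : ℝ) ^ k + 1 = 2 ^ k * (1 / 2 ^ k + 1) := by field_simp; ring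
      _ ≤ _ := by gcongr
  calc ((2 : ℝ) ^ k + 1) ^ m ≤ (2 ^ k * Real.exp (1 / 2 ^ k)) ^ m := by gcongr
    _ = Real.exp (m * (1 / 2 ^ k)) * 2 ^ (m * k) := by
        rw [mul_pow, ← Real.exp_nat_mul, ← pow_mul, mul_comm k m, mul_comm]
    _ ≤ 3 * 2 ^ (m * k) := by
        gcongr
        calc Real.exp (m * (1 / 2 ^ k)) ≤ Real.exp 1 := by
              apply Real.exp_le_exp.mpr
              rw [mul_one_div, div_le_one hq]
              exact hm'
          _ ≤ 3 := by linarith [Real.exp_one_lt_d9]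

end ShallowQST

end

theorem theorem2 :
    -- complete families of mutually unbiased stabilizer bases exist
    (∀ k : ℕ, 0 < k →
      ∃ U : Fin (2 ^ k + 1) → ShallowQST.Op (Fin k), ShallowQST.IsStabilizerMUB U) ∧
    -- guarantees for all choices of such a family in every block, with universal constants
    ∃ C D : ℝ, 0 < C ∧ 0 < D ∧
      ∀ n k m : ℕ, 0 < k → n = m * k →
      ∀ U : Fin m → Fin (2 ^ k + 1) → ShallowQST.Op (Fin k),
        (∀ i, ShallowQST.IsStabilizerMUB (U i)) →
        -- depth of the measurement circuits
        (∀ j : ShallowQST.Setting m k, ∃ c : ShallowQST.Circuit m k,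
          ShallowQST.SameBasis (ShallowQST.Circuit.toOp c) (ShallowQST.settingUnitary U j) ∧
          (c.length : ℝ) ≤ D * k ∧
          ∀ κ : ℝ, (k : ℝ) ≤ κ * Real.logb 2 n → (c.length : ℝ) ≤ D * κ * Real.logb 2 n) ∧
        ∀ ρ : ShallowQST.Op (Fin m × Fin k), ShallowQST.IsDensityMatrix ρ →
          -- the estimator is unbiased
          (∀ M : ℕ, 0 < M → ∀ s t,
            MeasureTheory.Integrable
              (fun x => ShallowQST.estimator U x s t) (ShallowQST.experiment U M ρ) ∧
            ∫ x, ShallowQST.estimator U x s t ∂(ShallowQST.experiment U M ρ) = ρ s t) ∧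
          -- sample complexity, with `T = M * (2 ^ k + 1) ^ m` and `d = 2 ^ n`
          (n ≤ k * 2 ^ k → ∀ ε δ : ℝ, 0 < ε → 0 < δ → δ < 1 →
            (∀ M : ℕ, 0 < M →
              C * (1 + √(2 * Real.log (1 / δ))) ^ 2 * ((2 : ℝ) ^ n) ^ 3 / ε ^ 2
                ≤ (M : ℝ) * (2 ^ k + 1) ^ m →
              ShallowQST.experiment U M ρ
                  {x | ε ≤ ShallowQST.traceNorm (ShallowQST.estimator U x - ρ)}
                ≤ ENNReal.ofReal δ) ∧
            (ε ≤ (2 : ℝ) ^ n → ∃ M : ℕ, 0 < M ∧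
              C * (1 + √(2 * Real.log (1 / δ))) ^ 2 * ((2 : ℝ) ^ n) ^ 3 / ε ^ 2
                ≤ (M : ℝ) * (2 ^ k + 1) ^ m ∧
              (M : ℝ) * (2 ^ k + 1) ^ m
                ≤ 2 * (C * (1 + √(2 * Real.log (1 / δ))) ^ 2 * ((2 : ℝ) ^ n) ^ 3 / ε ^ 2))) := by
  refine ⟨ShallowQST.exists_isStabilizerMUB, 3, 2, by norm_num, by norm_num, ?_⟩
  rintro n k m hk rfl U hU
  refine ⟨fun j => ?_, fun ρ hρ => ⟨fun M hM s t => ShallowQST.integral_estimator hU hρ hM s t,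
    fun hn ε δ hε hδ hδ1 => ?_⟩⟩
  · obtain ⟨c, hc, hlen⟩ := ShallowQST.exists_circuit fun i => (hU i).clifford (j i)
    have hlen' : (c.length : ℝ) = 2 * k := by rw [hlen]; push_cast; ring
    refine ⟨c, hc, hlen'.le, fun κ hκ => ?_⟩
    rw [hlen', mul_assoc]
    exact mul_le_mul_of_nonneg_left hκ zero_le_two
  · have hw := ShallowQST.settings_le hk hn
    set d : ℝ := 2 ^ (m * k) with hd
    set w : ℝ := (2 ^ k + 1) ^ m with hwdef
    set s : ℝ := √(2 * Real.log (1 / δ)) with hs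
    have hd0 : 0 < d := by positivity
    have hw0 : 0 < w := by positivity
    have hs0 : 0 ≤ s := Real.sqrt_nonneg _
    have hlog : 0 ≤ Real.log (1 / δ) := Real.log_nonneg ((one_le_div hδ).mpr hδ1.le)
    have hexp : Real.exp (-s ^ 2 / 2) = δ := by
      rw [hs, Real.sq_sqrt (by positivity), one_div, Real.log_inv]
      rw [show -(2 * -Real.log δ) / 2 = Real.log δ by ring, Real.exp_log hδ]
    refine ⟨fun M hM hT => ?_, fun hεd => ?_⟩
    · have hM' : (0 : ℝ) < M := Nat.cast_pos.mpr hM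
      rw [← hexp]
      refine ShallowQST.estimator_concentration hU hρ hM hs0 ?_
      -- `3 (1 + s)² d³ ≤ ε² M w ≤ 3 ε² M d`
      have h1 : ((1 + s) * d) ^ 2 ≤ ε ^ 2 * M := by
        rw [div_le_iff₀ (by positivity)] at hT
        have h2 : (M : ℝ) * w * ε ^ 2 ≤ M * (3 * d) * ε ^ 2 := by gcongr
        have h3 : 3 * d * ((1 + s) * d) ^ 2 ≤ 3 * d * (ε ^ 2 * M) := by linarith
        exact le_of_mul_le_mul_left h3 (by positivity)
      refine le_of_sq_le_sq ?_ hε.le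
      rw [← hd, show d * (√(1 / M) * (1 + s)) = √(1 / M) * ((1 + s) * d) by ring, mul_pow,
        Real.sq_sqrt (by positivity), one_div, inv_mul_le_iff₀ hM']
      linarith
    · set A : ℝ := 3 * (1 + s) ^ 2 * d ^ 3 / ε ^ 2 with hA
      have hwA : w ≤ A := by
        refine hw.trans ?_
        rw [hA, le_div_iff₀ (by positivity)]
        have h1 : ε ^ 2 ≤ d ^ 2 := by gcongr
        have h2 : 1 ≤ (1 + s) ^ 2 := one_le_pow₀ (by linarith)
        calc 3 * d * ε ^ 2 ≤ 3 * d * d ^ 2 := by gcongr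
          _ = 3 * 1 * d ^ 3 := by ring
          _ ≤ 3 * (1 + s) ^ 2 * d ^ 3 := by gcongr
      have hA0 : 0 < A := hw0.trans_le hwA
      refine ⟨⌈A / w⌉₊, Nat.ceil_pos.mpr (by positivity), ?_, ?_⟩
      · rw [← div_le_iff₀ hw0]
        exact Nat.le_ceil _
      · have h1 := (Nat.ceil_lt_add_one (a := A / w) (by positivity)).le
        calc (⌈A / w⌉₊ : ℝ) * w ≤ (A / w + 1) * w := by gcongr
          _ = A + w := by field_simp
          _ ≤ 2 * A := by linarith
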